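/- Let $\mathbb{K}$ be $\mathbb{R}$, $\mathbb{C}$ or $\mathbb{H}$, let $\mathcal{M}_n(\mathbb{K})$ be the space of $n\times n$ matrices over $\mathbb{K}$, and for $p\ge 0$ let $$O(p)=O(p,\mathbb{K})=\{A\in \mathcal{M}_p(\mathbb{K}) : AA^*=I\},$$ where $*$ is the conjugate transpose (so $O(p)$ is the orthogonal, unitary or symplectic group). For $p\ge 1$ let $\Sigma(p)$ be the disjoint union $G_0^p\sqcup\cdots\sqcup G_p^p$ of the Grassmannians $$G_q^p=\frac{O(p)}{O(q)\times O(p-q)},\qquad 0\le q\le p .$$ Let $X\in\mathcal{M}_n(\mathbb{K})$, let $0<t_1<\dots<t_k$ be the distinct nonzero singular values of $X$, let $n_q\geq 1$ be the multiplicity of $t_q$ as a singular value ($1\le q\le k$), and let $n_0\ge 0$ be the multiplicity of the singular value $0$; that is, $n_q$ and $n_0$ are the dimensions over $\mathbb{K}$ of the kernels of $X^*X-t_q^2I$ and of $X^*X$ in the right $\mathbb{K}$-vector space $\mathbb{K}^n$. Then the critical set $\Sigma(h_X)$ of the smooth function $$h_X\colon O(n,\mathbb{K})\to\mathbb{R},\qquad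 h_X(A)=\mathrm{Re}\,\mathrm{Tr}(X^*A),$$ is an embedded smooth submanifold of $\mathcal{M}_n(\mathbb{K})$ (whose components may have different dimensions), and there is a diffeomorphism $$\Sigma(h_X)\cong O(n_0)\times\Sigma(n_1)\times\cdots\times\Sigma(n_k).$$ -/

import Mathlib

open scoped Matrix Quaternion ContDiff Topology

attribute [local instance] Matrix.normedAddCommGroup Matrix.normedSpace

/-! ### The scalars -/

/-- `IsRCH K re` says that `K`, with its norm, real algebra structure and conjugation, is one of
the reals, the complex numbers or the quaternions, and that `re` is its real part. -/
inductive IsRCH : (K : Type) → [NormedDivisionRing K] → [NormedAlgebra ℝ K] → [StarRing K] →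
    (K → ℝ) → Prop
  | real : IsRCH ℝ (fun x => x)
  | complex : IsRCH ℂ (fun z => z.re)
  | quaternion : IsRCH ℍ[ℝ] (fun q => q.re)

/-! ### Diffeologies on subsets, products, disjoint unions and quotients

Mathlib's diffeological spaces are used to give subsets, products, disjoint unions and quotients of
manifolds their smooth structure. Manifolds (whose components may have different dimensions) form a
full subcategory of diffeological spaces, on which these constructions are the usual ones: an
embedded submanifold has the subset diffeology, and the base of a surjective submersion, such as
`G ⧸ H` for a closed subgroup `H` of a Lie group `G`, has the quotient diffeology. -/

namespace DiffeologicalSpace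

open Diffeology

/-- A map that is a plot in a neighbourhood of `x` agrees near `x` with a global plot. -/
theorem exists_plot_eventuallyEq {M : Type*}
    {plot : ∀ d : ℕ, (EuclideanSpace ℝ (Fin d) → M) → Prop} {d : ℕ}
    {p : EuclideanSpace ℝ (Fin d) → M} {x : EuclideanSpace ℝ (Fin d)}
    (h : ∃ u : Set (EuclideanSpace ℝ (Fin d)), IsOpen u ∧ x ∈ u ∧
      ∀ {e : ℕ} {f : EuclideanSpace ℝ (Fin e) → EuclideanSpace ℝ (Fin d)},
        (∀ y, f y ∈ u) → ContDiff ℝ ∞ f → plot e (p ∘ f)) :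
    ∃ q, plot d q ∧ p =ᶠ[𝓝 x] q := by
  obtain ⟨u, hu, hxu, hp⟩ := h
  obtain ⟨ε, hε, hball⟩ := Metric.isOpen_iff.mp hu x hxu
  let χ : ContDiffBump x := ⟨ε / 2, ε, half_pos hε, half_lt_self hε⟩
  let f : EuclideanSpace ℝ (Fin d) → EuclideanSpace ℝ (Fin d) := fun y => x + χ y • (y - x)
  have hf : ContDiff ℝ ∞ f :=
    contDiff_const.add (χ.contDiff.smul (contDiff_id.sub contDiff_const))
  refine ⟨p ∘ f, hp (fun y => hball ?_) hf, ?_⟩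
  · rw [Metric.mem_ball, dist_eq_norm]
    have hfy : f y - x = χ y • (y - x) := by simp [f]
    rw [hfy, norm_smul, Real.norm_of_nonneg χ.nonneg]
    by_cases hy : dist y x < ε
    · rw [dist_eq_norm] at hy
      exact (mul_le_of_le_one_left (norm_nonneg _) χ.le_one).trans_lt hy
    · rw [χ.zero_of_le_dist (not_lt.mp hy), zero_mul]
      exact hε
  · filter_upwards [χ.eventuallyEq_one] with y hy
    have hy' : χ y = 1 := hy
    simp [f, hy']

/-- The final diffeology of a jointly surjective family of maps: the plots are the maps that
locally lift to a plot of one of the sources. -/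
@[reducible] def coinduced {ι : Type*} {M : ι → Type*} {N : Type*}
    [∀ i, DiffeologicalSpace (M i)] (f : ∀ i, M i → N) (hf : ∀ y, ∃ i x, f i x = y) :
    DiffeologicalSpace N where
  plots d := {p | ∀ x, ∃ (i : ι) (q : EuclideanSpace ℝ (Fin d) → M i),
    IsPlot q ∧ p =ᶠ[𝓝 x] fun y => f i (q y)}
  constant_plots a x := by
    obtain ⟨i, b, hb⟩ := hf a
    exact ⟨i, fun _ => b, isPlot_const, by simp [hb]⟩
  plot_reparam := by
    intro d e p g hp hg x
    obtain ⟨i, q, hq, hpq⟩ := hp (g x)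
    exact ⟨i, q ∘ g, isPlot_reparam hq hg, hg.continuous.continuousAt.eventually hpq⟩
  locality := by
    intro d p h x
    obtain ⟨r, hr, hpr⟩ := exists_plot_eventuallyEq
      (plot := fun d (p : EuclideanSpace ℝ (Fin d) → N) =>
        ∀ x, ∃ (i : ι) (q : EuclideanSpace ℝ (Fin d) → M i),
          IsPlot q ∧ p =ᶠ[𝓝 x] fun y => f i (q y)) (h x)
    obtain ⟨i, q, hq, hrq⟩ := hr x
    exact ⟨i, q, hq, hpr.trans hrq⟩

/-- Matrices, as a finite-dimensional real vector space: the plots are the smooth maps. -/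
noncomputable instance instMatrix {m n : Type*} [Fintype m] [Fintype n] {K : Type*}
    [NormedAddCommGroup K] [NormedSpace ℝ K] [FiniteDimensional ℝ K] :
    DiffeologicalSpace (Matrix m n K) :=
  NormedSpace.toDiffeology (Matrix m n K)

/-- The subset diffeology. -/
instance instSubtype {M : Type*} [DiffeologicalSpace M] (P : M → Prop) :
    DiffeologicalSpace {x // P x} where
  plots _ := {p | IsPlot fun x => (p x : M)}
  constant_plots _ := isPlot_const
  plot_reparam hp hf := isPlot_reparam hp hf
  locality h := DiffeologicalSpace.locality h

/-- The product diffeology of two spaces. -/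
instance instProd {M N : Type*} [DiffeologicalSpace M] [DiffeologicalSpace N] :
    DiffeologicalSpace (M × N) where
  plots _ := {p | IsPlot (fun x => (p x).1) ∧ IsPlot (fun x => (p x).2)}
  constant_plots _ := ⟨isPlot_const, isPlot_const⟩
  plot_reparam hp hf := ⟨isPlot_reparam hp.1 hf, isPlot_reparam hp.2 hf⟩
  locality h := by
    constructor <;> refine DiffeologicalSpace.locality fun x => ?_ <;>
      obtain ⟨u, hu, hxu, hp⟩ := h x
    · exact ⟨u, hu, hxu, fun hfu hf => (hp hfu hf).1⟩
    · exact ⟨u, hu, hxu, fun hfu hf => (hp hfu hf).2⟩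

/-- The product diffeology of a family. -/
instance instPi {ι : Type*} {M : ι → Type*} [∀ i, DiffeologicalSpace (M i)] :
    DiffeologicalSpace (∀ i, M i) where
  plots _ := {p | ∀ i, IsPlot fun x => p x i}
  constant_plots _ _ := isPlot_const
  plot_reparam hp hf i := isPlot_reparam (hp i) hf
  locality h i := DiffeologicalSpace.locality fun x => by
    obtain ⟨u, hu, hxu, hp⟩ := h x
    exact ⟨u, hu, hxu, fun hfu hf => hp hfu hf i⟩

/-- The diffeology of a disjoint union. -/
instance instSigma {ι : Type*} {M : ι → Type*} [∀ i, DiffeologicalSpace (M i)] :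
    DiffeologicalSpace (Σ i, M i) :=
  coinduced (fun i => Sigma.mk i) fun y => ⟨y.1, y.2, rfl⟩

/-- The quotient diffeology on the space `G ⧸ H` of left cosets. -/
instance instQuotient {G : Type*} [Group G] [DiffeologicalSpace G] (H : Subgroup G) :
    DiffeologicalSpace (G ⧸ H) :=
  coinduced (fun _ : Unit => (QuotientGroup.mk : G → G ⧸ H))
    fun y => ⟨(), QuotientGroup.mk_surjective y⟩

end DiffeologicalSpace

/-- Diffeomorphisms: bijections that are smooth in both directions. -/
structure SmoothEquiv (M N : Type*) [DiffeologicalSpace M] [DiffeologicalSpace N]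
    extends M ≃ N where
  smooth_toFun : Diffeology.DSmooth toFun
  smooth_invFun : Diffeology.DSmooth invFun

/-- `S` is an embedded smooth submanifold of the normed space `E` (its components may have
different dimensions): around each of its points there is a smooth chart of `E` that carries `S`
to a linear subspace. -/
def IsSmoothSubmanifold {E : Type*} [NormedAddCommGroup E] [NormedSpace ℝ E] (S : Set E) : Prop :=
  ∀ x ∈ S, ∃ (W : Submodule ℝ E) (e : OpenPartialHomeomorph E E), x ∈ e.source ∧
    ContDiffOn ℝ ∞ e e.source ∧ ContDiffOn ℝ ∞ e.symm e.target ∧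
    ∀ y ∈ e.source, (y ∈ S ↔ e y ∈ W)

/-! ### Orthogonal groups, Grassmannians, height functions -/

section

variable (K : Type) [NormedDivisionRing K] [NormedAlgebra ℝ K] [StarRing K]

/-- The group `O(n, K)` of the matrices `A` with `A A* = A* A = 1`. -/
abbrev OGroup (n : ℕ) : Type := unitary (Matrix (Fin n) (Fin n) K)

/-- The subgroup `O(q) × O(p - q)` of `O(p)`: the matrices in `O(p)` which are block diagonal for
the partition of the `p` indices into the first `q` and the last `p - q`. -/
def blockSubgroup (p q : ℕ) : Subgroup (OGroup K p) where
  carrier := {A | ∀ i j : Fin p, ¬((i : ℕ) < q ↔ (j : ℕ) < q) →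
    (A : Matrix (Fin p) (Fin p) K) i j = 0}
  one_mem' := by
    intro i j hij
    have hne : i ≠ j := by
      rintro rfl
      exact hij Iff.rfl
    simp [Matrix.one_apply_ne hne]
  mul_mem' := by
    intro A B hA hB i j hij
    simp only [Submonoid.coe_mul, Matrix.mul_apply]
    refine Finset.sum_eq_zero fun l _ => ?_
    by_cases hl : (i : ℕ) < q ↔ (l : ℕ) < q
    · rw [hB l j fun h => hij (hl.trans h), mul_zero]
    · rw [hA i l hl, zero_mul]
  inv_mem' := by
    intro A hA i j hij
    have h : ((A⁻¹ : OGroup K p) : Matrix (Fin p) (Fin p) K) =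
        (A : Matrix (Fin p) (Fin p) K)ᴴ := rfl
    rw [h, Matrix.conjTranspose_apply, hA j i fun h => hij h.symm, star_zero]

/-- The Grassmannian `O(p) / (O(q) × O(p - q))`. -/
abbrev Grassmannian (p q : ℕ) : Type := OGroup K p ⧸ blockSubgroup K p q

/-- The disjoint union `Σ(p)` of the Grassmannians `O(p) / (O(q) × O(p - q))`, `0 ≤ q ≤ p`. -/
abbrev GrassmannianUnion (p : ℕ) : Type := Σ q : Fin (p + 1), Grassmannian K p q

variable {K} {n : ℕ}

/-- The height function `h_X(A) = Re Tr (X* A)` on `O(n, K)`. -/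
def heightFunction (re : K → ℝ) (X : Matrix (Fin n) (Fin n) K) (A : OGroup K n) : ℝ :=
  re (Xᴴ * (A : Matrix (Fin n) (Fin n) K)).trace

/-- The critical set of a function `h` on `O(n, K)`: the points at which the derivative of `h`
vanishes along every smooth curve of `O(n, K)` through the point. -/
def criticalSet (h : OGroup K n → ℝ) : Set (OGroup K n) :=
  {A | ∀ γ : ℝ → OGroup K n, ContDiff ℝ ∞ (fun s => (γ s : Matrix (Fin n) (Fin n) K)) →
    γ 0 = A → HasDerivAt (fun s => h (γ s)) 0 0}

/-- The eigenspace of `X* X` for the eigenvalue `t ^ 2`, as a right `K`-subspace of `K ^ n`. -/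
def singularSubspace (X : Matrix (Fin n) (Fin n) K) (t : ℝ) : Submodule Kᵐᵒᵖ (Fin n → K) where
  carrier := {v | (Xᴴ * X) *ᵥ v = t ^ 2 • v}
  zero_mem' := by simp
  add_mem' := by
    intro v w hv hw
    simp only [Set.mem_ofPred_eq] at hv hw ⊢
    rw [Matrix.mulVec_add, hv, hw, smul_add]
  smul_mem' := by
    intro c v hv
    simp only [Set.mem_ofPred_eq] at hv ⊢
    rw [Matrix.mulVec_smul, hv, smul_comm]

/-- `t` is a singular value of `X`: the nonnegative square root of an eigenvalue of `X* X`. -/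
def IsSingularValue (X : Matrix (Fin n) (Fin n) K) (t : ℝ) : Prop :=
  0 ≤ t ∧ singularSubspace X t ≠ ⊥

/-- The multiplicity of `t ≥ 0` as a singular value of `X` (it is `0` if `t` is not one): the
dimension over `K` of the eigenspace of `X* X` for `t ^ 2`. -/
noncomputable def singularMultiplicity (X : Matrix (Fin n) (Fin n) K) (t : ℝ) : ℕ :=
  Module.finrank Kᵐᵒᵖ (singularSubspace X t)

end

/-!
The critical points `A` of `h_X(A) = Re Tr (X* A)` on `O(n, K)` are the unitary `A` for which
`X* A` is Hermitian: the tangent vectors at `A` are the `A Z` with `Z` skew-Hermitian, and for the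
real inner product `Re Tr` the Hermitian matrices are the orthogonal complement of the
skew-Hermitian ones (`IsRealPart.mem_criticalSet_of_isHermitian` and
`IsRealPart.isHermitian_of_mem_criticalSet`).

*Submanifold.* At a critical point `B` take the Cayley chart `A ↦ Z`, where `B* A` is the Cayley
transform `(1 - Z) (1 + Z)⁻¹`. Then `A` is unitary exactly if `Z` is skew-Hermitian, and `X* A` is
Hermitian exactly if `Z` also anticommutes with the Hermitian matrix `X* B`. These conditions are
linear in `Z`, so a single explicit chart straightens the critical set
(`isSmoothSubmanifold_unitary_isHermitian`).

*Block decomposition.* Write `X = U D V*` with `U`, `V` unitary and `D` diagonal, real and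
nonnegative. Mathlib has no spectral theorem over `ℍ`; the decomposition is obtained from the
compactness of `O(n, K)`, by maximizing `Re Tr (N U* X V)` with `N = diag(1, …, n)`
(`IsRealPart.exists_svd`). For `C = U* A V` the critical equation reads `D C = C* D`. It says that
`C` is block diagonal for the partition of the indices by the entries of `D`, with an arbitrary
unitary block for the entry `0` and Hermitian unitary blocks for the others
(`isHermitian_realDiagonal_mul_iff`, `IsRealPart.criticalSetEquiv`).

*Grassmannians.* The Hermitian unitary matrices of size `p` form the space `Σ(p)`: the coset of `B`
in `O(p) / (O(q) × O(p - q))` corresponds to `B I_q B*`, where `I_q` has `q` diagonal entries `1`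
and `p - q` entries `-1`. Injectivity is the fact that commuting with `I_q` means being block
diagonal (the trace recovers `q`), and surjectivity follows from the singular value decomposition
of the projection `(1 + A) / 2`. For the smoothness of the inverse, a Hermitian unitary `A` near
`A₀` is `R A₀ R*`, where `R*` is the square root of `A₀ A` near `1`, which depends smoothly on `A`
by the inverse function theorem (`exists_local_conjugation`,
`IsRealPart.grassmannianUnionEquiv`).
-/

/-! ### The real part -/

/-- The properties of the real part `re` of `ℝ`, `ℂ` and `ℍ` that the argument uses. -/
structure IsRealPart {K : Type*} [NormedDivisionRing K] [NormedAlgebra ℝ K] [StarRing K]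
    (re : K →ₗ[ℝ] ℝ) : Prop where
  re_mul_comm : ∀ x y, re (x * y) = re (y * x)
  re_star : ∀ x, re (star x) = re x
  re_star_mul_self : ∀ x, re (star x * x) = ‖x‖ ^ 2
  algebraMap_re : ∀ x, star x = x → algebraMap ℝ K (re x) = x

theorem IsRCH.exists_isRealPart {K : Type} [NormedDivisionRing K] [NormedAlgebra ℝ K]
    [StarRing K] {re : K → ℝ} (hK : IsRCH K re) :
    StarModule ℝ K ∧ ∃ f : K →ₗ[ℝ] ℝ, re = f ∧ IsRealPart f := by
  cases hK with
  | real =>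
    refine ⟨inferInstance, LinearMap.id, rfl, ⟨mul_comm, fun _ => rfl, fun x => ?_, fun _ _ => rfl⟩⟩
    simp [sq]
  | complex =>
    refine ⟨inferInstance, Complex.reLm, rfl, ⟨?_, ?_, ?_, ?_⟩⟩
    · intro x y; rw [mul_comm]
    · intro x; simp
    · intro x
      have : ‖x‖ ^ 2 = x.re * x.re + x.im * x.im := by
        rw [← Complex.normSq_eq_norm_sq, Complex.normSq_apply]
      simp [this]
    · intro x hx
      exact (Complex.conj_eq_iff_re.mp hx)
  | quaternion =>
    refine ⟨⟨fun r q => ?_⟩, ⟨⟨fun q => q.re, fun _ _ => rfl⟩, fun _ _ => rfl⟩, rfl,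
      ⟨?_, ?_, ?_, ?_⟩⟩
    · change star (r • q) = r • star q
      exact Quaternion.star_smul r q
    · intro x y
      change (x * y).re = (y * x).re
      rw [Quaternion.re_mul, Quaternion.re_mul]
      ring
    · intro x
      exact Quaternion.re_star x
    · intro x
      change (star x * x).re = ‖x‖ ^ 2
      rw [sq, ← Quaternion.normSq_eq_norm_mul_self, Quaternion.normSq_def', Quaternion.re_mul,
        Quaternion.re_star, Quaternion.imI_star, Quaternion.imJ_star, Quaternion.imK_star]
      ring
    · intro x hx
      exact (Quaternion.star_eq_self.mp hx).symm

section

variable {K : Type*} [NormedDivisionRing K] [NormedAlgebra ℝ K] [StarRing K]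
variable {ι κ : Type*} [Fintype ι] [Fintype κ]

namespace IsRealPart

variable {re : K →ₗ[ℝ] ℝ} (hre : IsRealPart re)
include hre

theorem re_one : re 1 = 1 := by
  simpa using hre.re_star_mul_self 1

theorem re_trace_mul_comm (A : Matrix ι κ K) (B : Matrix κ ι K) :
    re (A * B).trace = re (B * A).trace := by
  simp only [Matrix.trace, Matrix.diag, Matrix.mul_apply, map_sum]
  rw [Finset.sum_comm]
  exact Finset.sum_congr rfl fun _ _ => Finset.sum_congr rfl fun _ _ => hre.re_mul_comm _ _

theorem re_trace_conjTranspose (A : Matrix ι ι K) : re Aᴴ.trace = re A.trace := by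
  rw [Matrix.trace_conjTranspose, hre.re_star]

theorem re_trace_conjTranspose_mul_self (A : Matrix ι κ K) :
    re (Aᴴ * A).trace = ∑ j, ∑ i, ‖A i j‖ ^ 2 := by
  simp only [Matrix.trace, Matrix.diag, Matrix.mul_apply, map_sum, Matrix.conjTranspose_apply,
    hre.re_star_mul_self]

theorem eq_zero_of_re_trace {A : Matrix ι κ K} (h : re (Aᴴ * A).trace = 0) : A = 0 := by
  rw [hre.re_trace_conjTranspose_mul_self,
    Finset.sum_eq_zero_iff_of_nonneg fun _ _ => by positivity] at h
  ext i j
  have := (Finset.sum_eq_zero_iff_of_nonneg fun _ _ => by positivity).mp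
    (h j (Finset.mem_univ j)) i (Finset.mem_univ i)
  simpa using this

/-- For the real inner product `re (Aᴴ * B).trace`, a matrix is orthogonal to all
skew-Hermitian matrices only if it is Hermitian. -/
theorem isHermitian_of_re_trace_mul_eq_zero {M : Matrix ι ι K}
    (h : ∀ Z : Matrix ι ι K, Zᴴ = -Z → re (M * Z).trace = 0) : M.IsHermitian := by
  have hZ : (M - Mᴴ)ᴴ = -(M - Mᴴ) := by simp
  have h1 := h _ hZ
  have h2 : re (Mᴴ * (M - Mᴴ)).trace = 0 := by
    rw [← hre.re_trace_conjTranspose, Matrix.conjTranspose_mul, hZ,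
      Matrix.conjTranspose_conjTranspose, hre.re_trace_mul_comm, mul_neg, Matrix.trace_neg,
      map_neg, h1, neg_zero]
  have h3 : M - Mᴴ = 0 := by
    apply hre.eq_zero_of_re_trace
    rw [hZ, neg_mul, Matrix.trace_neg, map_neg, sub_mul M, Matrix.trace_sub, map_sub, h1, h2]
    simp
  exact (sub_eq_zero.mp h3).symm

theorem re_trace_mul_eq_zero {M Z : Matrix ι ι K} (hM : M.IsHermitian) (hZ : Zᴴ = -Z) :
    re (M * Z).trace = 0 := by
  have h : re (M * Z).trace = -re (M * Z).trace := by
    conv_lhs => rw [← hre.re_trace_conjTranspose, Matrix.conjTranspose_mul, hZ, hM.eq,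
      neg_mul, Matrix.trace_neg, map_neg, hre.re_trace_mul_comm]
  linarith

theorem norm_apply_le_one_of_mem_unitary [DecidableEq ι] {A : Matrix ι ι K}
    (hA : A ∈ unitary (Matrix ι ι K)) (i j : ι) : ‖A i j‖ ≤ 1 := by
  have h : (Aᴴ * A) j j = 1 := by
    rw [← Matrix.star_eq_conjTranspose, Unitary.star_mul_self_of_mem hA, Matrix.one_apply_eq]
  have h' : ∑ l, ‖A l j‖ ^ 2 = 1 := by
    have := congrArg re h
    rwa [Matrix.mul_apply, map_sum, hre.re_one, Finset.sum_congr rfl fun l _ => by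
      rw [Matrix.conjTranspose_apply, hre.re_star_mul_self]] at this
  have h2 : ‖A i j‖ ^ 2 ≤ 1 := h' ▸
    Finset.single_le_sum (f := fun l => ‖A l j‖ ^ 2) (fun _ _ => by positivity) (Finset.mem_univ i)
  exact (sq_le_one_iff₀ (norm_nonneg _)).mp h2

/-- `1 + Z` is injective for skew-Hermitian `Z`, because `re (v* Z v) = 0`. -/
theorem eq_zero_of_mulVec_one_add [DecidableEq ι] {Z : Matrix ι ι K} (hZ : Zᴴ = -Z) {v : ι → K}
    (hv : (1 + Z) *ᵥ v = 0) : v = 0 := by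
  let V : Matrix ι Unit K := Matrix.of fun i _ => v i
  have hV : Z * V = -V := by
    ext i j
    have := congrFun hv i
    rw [Matrix.add_mulVec, Matrix.one_mulVec, Pi.add_apply, Pi.zero_apply] at this
    exact (neg_eq_of_add_eq_zero_right this).symm
  have h0 : re (Vᴴ * (Z * V)).trace = -re (Vᴴ * (Z * V)).trace := by
    conv_lhs => rw [← hre.re_trace_conjTranspose, Matrix.conjTranspose_mul,
      Matrix.conjTranspose_conjTranspose, Matrix.conjTranspose_mul, hZ, Matrix.mul_neg,
      Matrix.neg_mul, Matrix.trace_neg, map_neg, Matrix.mul_assoc]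
  have h1 : V = 0 := by
    apply hre.eq_zero_of_re_trace
    rw [hV, Matrix.mul_neg, Matrix.trace_neg, map_neg] at h0
    linarith
  ext i
  exact congrFun (congrFun h1 i) ()

end IsRealPart

end

/-! ### Smooth maps of matrices -/

section

variable {K : Type*} [NormedDivisionRing K] [NormedAlgebra ℝ K]
variable {ι κ : Type*} [Fintype ι] [Fintype κ]

theorem LinearMap.contDiff_of_finiteDimensional {E F : Type*} [NormedAddCommGroup E]
    [NormedSpace ℝ E] [FiniteDimensional ℝ E] [NormedAddCommGroup F] [NormedSpace ℝ F]
    {k : WithTop ℕ∞} (f : E →ₗ[ℝ] F) : ContDiff ℝ k f :=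
  f.toContinuousLinearMap.contDiff

theorem contDiffAt_matrix {E : Type*} [NormedAddCommGroup E] [NormedSpace ℝ E]
    {k : WithTop ℕ∞} {f : E → Matrix ι κ K} {x : E} :
    ContDiffAt ℝ k f x ↔ ∀ i j, ContDiffAt ℝ k (fun y => f y i j) x := by
  refine (contDiffAt_pi (Φ := fun y i => f y i)).trans (forall_congr' fun i => ?_)
  exact contDiffAt_pi (Φ := fun y j => f y i j)

theorem contDiff_matrix {E : Type*} [NormedAddCommGroup E] [NormedSpace ℝ E]
    {k : WithTop ℕ∞} {f : E → Matrix ι κ K} :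
    ContDiff ℝ k f ↔ ∀ i j, ContDiff ℝ k fun y => f y i j := by
  simp only [contDiff_iff_contDiffAt, contDiffAt_matrix]
  exact ⟨fun h i j x => h x i j, fun h x i j => h i j x⟩

theorem ContDiffAt.matrix_mul {E : Type*} [NormedAddCommGroup E] [NormedSpace ℝ E]
    {k : WithTop ℕ∞} {μ : Type*} [Fintype μ] {f : E → Matrix ι κ K} {g : E → Matrix κ μ K} {x : E}
    (hf : ContDiffAt ℝ k f x) (hg : ContDiffAt ℝ k g x) :
    ContDiffAt ℝ k (fun y => f y * g y) x := by
  rw [contDiffAt_matrix] at *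
  intro i j
  simp only [Matrix.mul_apply]
  exact ContDiffAt.sum fun l _ => (hf i l).mul (hg l j)

theorem ContDiff.matrix_mul {E : Type*} [NormedAddCommGroup E] [NormedSpace ℝ E]
    {k : WithTop ℕ∞} {μ : Type*} [Fintype μ] {f : E → Matrix ι κ K} {g : E → Matrix κ μ K}
    (hf : ContDiff ℝ k f) (hg : ContDiff ℝ k g) : ContDiff ℝ k (fun y => f y * g y) :=
  contDiff_iff_contDiffAt.mpr fun _ => hf.contDiffAt.matrix_mul hg.contDiffAt

variable [FiniteDimensional ℝ K]

theorem contDiff_star [StarRing K] [StarModule ℝ K] {k : WithTop ℕ∞} :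
    ContDiff ℝ k (star : K → K) :=
  (starLinearEquiv ℝ (A := K)).toLinearMap.contDiff_of_finiteDimensional

theorem contDiff_conjTranspose [StarRing K] [StarModule ℝ K] {k : WithTop ℕ∞} :
    ContDiff ℝ k (Matrix.conjTranspose : Matrix ι κ K → Matrix κ ι K) :=
  contDiff_matrix.mpr fun i j => contDiff_star.comp (contDiff_matrix.mp contDiff_id j i)

/-- A matrix as an endomorphism of the real vector space `ι → K`. The matrices carry the
entrywise norm, which is not submultiplicative; the operators form a normed ring. -/
noncomputable def mulVecEnd : Matrix ι ι K →ₗ[ℝ] ((ι → K) →L[ℝ] (ι → K)) where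
  toFun A := LinearMap.toContinuousLinearMap
    { toFun := fun v => A *ᵥ v
      map_add' := Matrix.mulVec_add A
      map_smul' := fun r v => Matrix.mulVec_smul A r v }
  map_add' A B := by ext v : 1; exact Matrix.add_mulVec A B v
  map_smul' r A := by ext v : 1; exact Matrix.smul_mulVec r A v

@[simp] theorem mulVecEnd_apply (A : Matrix ι ι K) (v : ι → K) : mulVecEnd A v = A *ᵥ v := rfl

theorem mulVecEnd_mul (A B : Matrix ι ι K) : mulVecEnd (A * B) = mulVecEnd A * mulVecEnd B := by
  ext v : 1
  simp [Matrix.mulVec_mulVec]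

theorem contDiff_mulVecEnd {k : WithTop ℕ∞} :
    ContDiff ℝ k (mulVecEnd : Matrix ι ι K → (ι → K) →L[ℝ] (ι → K)) :=
  LinearMap.contDiff_of_finiteDimensional (E := Matrix ι ι K) (F := (ι → K) →L[ℝ] (ι → K)) mulVecEnd

variable [DecidableEq ι]

theorem mulVecEnd_one : mulVecEnd (1 : Matrix ι ι K) = 1 := by
  ext v : 1
  simp

/-- The linear left inverse of `mulVecEnd` that reads off the columns of an operator. -/
noncomputable def columnsOfEnd : ((ι → K) →L[ℝ] (ι → K)) →ₗ[ℝ] Matrix ι ι K where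
  toFun T := Matrix.of fun i j => T (Pi.single j 1) i
  map_add' _ _ := rfl
  map_smul' _ _ := rfl

theorem columnsOfEnd_mulVecEnd (A : Matrix ι ι K) : columnsOfEnd (mulVecEnd A) = A := by
  ext i j
  change (A *ᵥ Pi.single j 1) i = A i j
  simp

theorem mulVecEnd_injective : Function.Injective (mulVecEnd : Matrix ι ι K →ₗ[ℝ] _) :=
  Function.LeftInverse.injective columnsOfEnd_mulVecEnd

theorem isUnit_of_mulVec_injective {A : Matrix ι ι K} (h : ∀ v, A *ᵥ v = 0 → v = 0) :
    IsUnit A := by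
  have hinj : Function.Injective (mulVecEnd A).toLinearMap :=
    (injective_iff_map_eq_zero _).mpr h
  have hsurj := LinearMap.injective_iff_surjective.mp hinj
  choose g hg using fun j : ι => hsurj (Pi.single j 1)
  have hAB : A * Matrix.of (fun i j => g j i) = 1 := by
    ext i j
    have := congrFun (hg j) i
    rw [Matrix.one_apply, Matrix.mul_apply]
    simpa [Matrix.mulVec, dotProduct, Pi.single_apply] using this
  refine ⟨⟨A, _, hAB, ?_⟩, rfl⟩
  apply mulVecEnd_injective
  ext v : 1
  apply hinj
  change (mulVecEnd A) _ = (mulVecEnd A) _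
  rw [mulVecEnd_apply, mulVecEnd_apply, mulVecEnd_apply, mulVecEnd_apply, Matrix.mulVec_mulVec,
    ← mul_assoc, hAB, one_mul, Matrix.one_mulVec]

theorem isUnit_mulVecEnd_iff {A : Matrix ι ι K} : IsUnit (mulVecEnd A) ↔ IsUnit A := by
  constructor
  · rintro ⟨u, hu⟩
    refine isUnit_of_mulVec_injective fun v hv => ?_
    have : (↑u⁻¹ * mulVecEnd A) v = 0 := by
      rw [mul_apply_eq_comp, mulVecEnd_apply, hv, map_zero]
    simpa [← hu] using this
  · rintro ⟨u, rfl⟩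
    exact ⟨⟨mulVecEnd u, mulVecEnd ↑u⁻¹, by rw [← mulVecEnd_mul, u.mul_inv, mulVecEnd_one],
      by rw [← mulVecEnd_mul, u.inv_mul, mulVecEnd_one]⟩, rfl⟩

theorem contDiff_columnsOfEnd {k : WithTop ℕ∞} :
    ContDiff ℝ k (columnsOfEnd : ((ι → K) →L[ℝ] (ι → K)) → Matrix ι ι K) :=
  LinearMap.contDiff_of_finiteDimensional (E := (ι → K) →L[ℝ] (ι → K)) (F := Matrix ι ι K)
    columnsOfEnd

theorem isOpen_isUnit_matrix : IsOpen {A : Matrix ι ι K | IsUnit A} := by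
  simp only [← isUnit_mulVecEnd_iff]
  exact (Units.isOpen (R := (ι → K) →L[ℝ] (ι → K))).preimage 
    (contDiff_mulVecEnd (K := K) (ι := ι) (k := 0)).continuous

theorem contDiffAt_matrix_ringInverse {k : WithTop ℕ∞} {A : Matrix ι ι K} (hA : IsUnit A) :
    ContDiffAt ℝ k Ring.inverse A := by
  have h0 : ContDiffAt ℝ k (Ring.inverse : ((ι → K) →L[ℝ] (ι → K)) → _) (mulVecEnd A) := by
    obtain ⟨u, hu⟩ := isUnit_mulVecEnd_iff.mpr hA
    rw [← hu]
    exact contDiffAt_ringInverse (R := (ι → K) →L[ℝ] (ι → K)) ℝ u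
  have h1 : ContDiffAt ℝ k (fun B : Matrix ι ι K => columnsOfEnd (Ring.inverse (mulVecEnd B))) A :=
    (contDiff_columnsOfEnd (K := K) (ι := ι)).contDiffAt.comp A
      (h0.comp A (contDiff_mulVecEnd (K := K) (ι := ι)).contDiffAt)
  refine h1.congr_of_eventuallyEq ?_
  filter_upwards [isOpen_isUnit_matrix.mem_nhds hA] with B hB
  have : Ring.inverse (mulVecEnd B) = mulVecEnd (Ring.inverse B) := by
    rw [← mul_one (Ring.inverse (mulVecEnd B)),
      Ring.inverse_mul_eq_iff_eq_mul _ _ _ (isUnit_mulVecEnd_iff.mpr hB), ← mulVecEnd_mul,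
      Ring.mul_inverse_cancel _ hB, mulVecEnd_one]
  rw [this, columnsOfEnd_mulVecEnd]

end

/-! ### The Cayley transform -/

section

variable {R : Type*} [Ring R]

/-- The Cayley transform `(1 - z) (1 + z)⁻¹`, which has the junk value `0` when `1 + z` is not
invertible. -/
noncomputable def cayley (z : R) : R := (1 - z) * Ring.inverse (1 + z)

@[simp] theorem cayley_zero : cayley (0 : R) = 1 := by simp [cayley]

theorem cayley_mul_one_add {z : R} (hz : IsUnit (1 + z)) : cayley z * (1 + z) = 1 - z := by
  rw [cayley, Ring.inverse_mul_cancel_right _ _ hz]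

theorem one_add_cayley {z : R} (hz : IsUnit (1 + z)) :
    1 + cayley z = 2 * Ring.inverse (1 + z) := by
  rw [Ring.eq_mul_inverse_iff_mul_eq _ _ _ hz, add_mul, cayley_mul_one_add hz, one_mul,
    ← one_add_one_eq_two]
  abel

theorem one_sub_cayley {z : R} (hz : IsUnit (1 + z)) :
    1 - cayley z = z * (1 + cayley z) := by
  rw [one_add_cayley hz, ← mul_assoc, Ring.eq_mul_inverse_iff_mul_eq _ _ _ hz, sub_mul,
    cayley_mul_one_add hz, one_mul, mul_two]
  abel

variable [Algebra ℝ R]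

theorem isUnit_two_of_real_algebra : IsUnit (2 : R) := by
  have h := (IsUnit.mk0 (2 : ℝ) two_ne_zero).map (algebraMap ℝ R)
  rwa [map_ofNat] at h

theorem isUnit_one_add_cayley {z : R} (hz : IsUnit (1 + z)) : IsUnit (1 + cayley z) := by
  rw [one_add_cayley hz]
  exact isUnit_two_of_real_algebra.mul hz.ringInverse

theorem cayley_cayley {z : R} (hz : IsUnit (1 + z)) : cayley (cayley z) = z := by
  conv_lhs => rw [cayley, one_sub_cayley hz]
  rw [Ring.mul_inverse_cancel_right _ _ (isUnit_one_add_cayley hz)]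

variable [StarRing R]

omit [Algebra ℝ R] in
theorem isUnit_one_sub_of_star_eq_neg {z : R} (hz : IsUnit (1 + z)) (h : star z = -z) :
    IsUnit (1 - z) := by
  have := hz.star
  rwa [star_add, star_one, h, ← sub_eq_add_neg] at this

omit [Algebra ℝ R] in
theorem one_sub_mul_star_cayley {z : R} (hz : IsUnit (1 + z)) (h : star z = -z) :
    (1 - z) * star (cayley z) = 1 + z := by
  have := congrArg star (cayley_mul_one_add hz)
  rwa [star_mul, star_add, star_sub, star_one, h, ← sub_eq_add_neg, sub_neg_eq_add] at this

omit [Algebra ℝ R] in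
theorem star_mul_self_cayley {z : R} (hz : IsUnit (1 + z)) (h : star z = -z) :
    star (cayley z) * cayley z = 1 := by
  apply (isUnit_one_sub_of_star_eq_neg hz h).mul_left_cancel
  apply hz.mul_right_cancel
  rw [← mul_assoc, one_sub_mul_star_cayley hz h, mul_assoc, cayley_mul_one_add hz]
  noncomm_ring

omit [Algebra ℝ R] in
theorem self_mul_star_cayley {z : R} (hz : IsUnit (1 + z)) (h : star z = -z) :
    cayley z * star (cayley z) = 1 := by
  have hu := isUnit_one_sub_of_star_eq_neg hz h
  have hc : cayley z = Ring.inverse (1 + z) * (1 - z) := by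
    rw [eq_comm, Ring.inverse_mul_eq_iff_eq_mul _ _ _ hz, cayley, ← mul_assoc,
      Ring.eq_mul_inverse_iff_mul_eq _ _ _ hz]
    noncomm_ring
  nth_rewrite 1 [hc]
  rw [mul_assoc, one_sub_mul_star_cayley hz h, Ring.inverse_mul_cancel _ hz]

omit [Algebra ℝ R] in
theorem cayley_mem_unitary {z : R} (hz : IsUnit (1 + z)) (h : star z = -z) :
    cayley z ∈ unitary R :=
  Unitary.mem_iff.mpr ⟨star_mul_self_cayley hz h, self_mul_star_cayley hz h⟩

omit [Algebra ℝ R] in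
theorem star_cayley_of_mem_unitary {w : R} (hw : IsUnit (1 + w)) (h : w ∈ unitary R) :
    star (cayley w) = -cayley w := by
  apply hw.star.mul_left_cancel
  apply hw.mul_right_cancel
  have h1 : star (1 + w) * star (cayley w) = 1 - star w := by
    rw [← star_mul, cayley_mul_one_add hw, star_sub, star_one]
  rw [h1, mul_assoc, neg_mul, cayley_mul_one_add hw, star_add, star_one, mul_neg]
  simp only [mul_add, add_mul, mul_sub, sub_mul, Unitary.star_mul_self_of_mem h, mul_one, one_mul]
  abel

theorem cayley_mem_unitary_iff {w : R} (hw : IsUnit (1 + w)) :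
    star (cayley w) = -cayley w ↔ w ∈ unitary R := by
  refine ⟨fun h => ?_, star_cayley_of_mem_unitary hw⟩
  rw [← cayley_cayley hw]
  exact cayley_mem_unitary (isUnit_one_add_cayley hw) h

/-- In the Cayley coordinate `z`, the condition that `p * w` is self-adjoint is linear. -/
theorem isSelfAdjoint_mul_cayley_iff {p z : R} (hp : star p = p) (hz : IsUnit (1 + z))
    (h : star z = -z) : star (p * cayley z) = p * cayley z ↔ p * z + z * p = 0 := by
  have hu := isUnit_one_sub_of_star_eq_neg hz h
  rw [star_mul, hp, ← hu.mul_right_inj, ← hz.mul_left_inj, ← mul_assoc,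
    one_sub_mul_star_cayley hz h, mul_assoc (1 - z), mul_assoc p, cayley_mul_one_add hz]
  have key : (1 + z) * p * (1 + z) - (1 - z) * (p * (1 - z)) = (2 : ℝ) • (p * z + z * p) := by
    rw [two_smul]
    noncomm_ring
  rw [← sub_eq_zero, key, smul_eq_zero]
  simp

end

/-! ### The Cayley charts of the unitary group -/

section

variable {K : Type*} [NormedDivisionRing K] [NormedAlgebra ℝ K] [FiniteDimensional ℝ K]
variable {ι : Type*} [Fintype ι] [DecidableEq ι]

theorem contDiffAt_cayley {k : WithTop ℕ∞} {Z : Matrix ι ι K} (hZ : IsUnit (1 + Z)) :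
    ContDiffAt ℝ k (cayley : Matrix ι ι K → Matrix ι ι K) Z :=
  (contDiffAt_const.sub contDiffAt_id).matrix_mul
    (ContDiffAt.comp (g := Ring.inverse) Z (contDiffAt_matrix_ringInverse hZ)
      (contDiffAt_const.add contDiffAt_id))

theorem ContDiffAt.cayley {E : Type*} [NormedAddCommGroup E] [NormedSpace ℝ E]
    {k : WithTop ℕ∞} {f : E → Matrix ι ι K} {x : E} (hf : ContDiffAt ℝ k f x)
    (hx : IsUnit (1 + f x)) : ContDiffAt ℝ k (fun y => cayley (f y)) x :=
  ContDiffAt.comp (g := _root_.cayley) x (contDiffAt_cayley hx) hf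

theorem isOpen_isUnit_one_add_mul (B : Matrix ι ι K) :
    IsOpen {A : Matrix ι ι K | IsUnit (1 + B * A)} :=
  isOpen_isUnit_matrix.preimage
    (contDiff_const.add (contDiff_const.matrix_mul contDiff_id) (𝕜 := ℝ) (n := 0)).continuous

variable [StarRing K]

/-- The chart `A ↦ cayley (B* A)` of the space of matrices around the unitary matrix `B`. -/
noncomputable def cayleyChart (B : Matrix ι ι K) (hB : B ∈ unitary (Matrix ι ι K)) :
    OpenPartialHomeomorph (Matrix ι ι K) (Matrix ι ι K) where
  toFun A := cayley (star B * A)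
  invFun Z := B * cayley Z
  source := {A | IsUnit (1 + star B * A)}
  target := {Z | IsUnit (1 + Z)}
  map_source' A hA := isUnit_one_add_cayley hA
  map_target' Z hZ := by
    change IsUnit (1 + star B * (B * cayley Z))
    rw [← mul_assoc, Unitary.star_mul_self_of_mem hB, one_mul]
    exact isUnit_one_add_cayley hZ
  left_inv' A hA := by
    rw [cayley_cayley hA, ← mul_assoc, Unitary.mul_star_self_of_mem hB, one_mul]
  right_inv' Z hZ := by
    rw [← mul_assoc, Unitary.star_mul_self_of_mem hB, one_mul, cayley_cayley hZ]
  open_source := isOpen_isUnit_one_add_mul _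
  open_target := by simpa using isOpen_isUnit_one_add_mul (1 : Matrix ι ι K)
  continuousOn_toFun A hA :=
    (ContDiffAt.cayley (k := 0) (contDiffAt_const.matrix_mul contDiffAt_id)
      hA).continuousAt.continuousWithinAt
  continuousOn_invFun Z hZ :=
    (ContDiffAt.matrix_mul (k := 0) contDiffAt_const
      (contDiffAt_cayley hZ)).continuousAt.continuousWithinAt

/-- The unitary matrices `A` for which `X* A` is Hermitian form a submanifold: in the Cayley chart
at one of them they are the skew-Hermitian `Z` that anticommute with the Hermitian matrix
`X* B`. -/
theorem isSmoothSubmanifold_unitary_isHermitian [StarModule ℝ K] (X : Matrix ι ι K) :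
    IsSmoothSubmanifold {A : Matrix ι ι K | A ∈ unitary (Matrix ι ι K) ∧ (Xᴴ * A).IsHermitian} := by
  rintro B ⟨hB, hXB⟩
  let W : Submodule ℝ (Matrix ι ι K) :=
    { carrier := {Z | star Z = -Z ∧ Xᴴ * B * Z + Z * (Xᴴ * B) = 0}
      zero_mem' := by simp
      add_mem' := by
        rintro Y Z ⟨hY, hY'⟩ ⟨hZ, hZ'⟩
        refine ⟨by rw [star_add, hY, hZ, neg_add], ?_⟩
        rw [mul_add, add_mul, add_add_add_comm, hY', hZ', add_zero]
      smul_mem' := by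
        rintro r Z ⟨hZ, hZ'⟩
        refine ⟨by rw [star_smul, hZ, star_trivial, smul_neg], ?_⟩
        rw [mul_smul_comm, smul_mul_assoc, ← smul_add, hZ', smul_zero] }
  refine ⟨W, cayleyChart B hB, ?_, fun A hA => ?_, fun Z hZ => ?_, fun A hA => ?_⟩
  · change IsUnit (1 + star B * B)
    rw [Unitary.star_mul_self_of_mem hB, one_add_one_eq_two]
    exact isUnit_two_of_real_algebra
  · exact ((contDiffAt_const.matrix_mul contDiffAt_id).cayley hA).contDiffWithinAt
  · exact (ContDiffAt.matrix_mul contDiffAt_const (contDiffAt_cayley hZ)).contDiffWithinAt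
  · change A ∈ unitary _ ∧ (Xᴴ * A).IsHermitian ↔ 
      star (cayley (star B * A)) = -cayley (star B * A) ∧
        Xᴴ * B * cayley (star B * A) + cayley (star B * A) * (Xᴴ * B) = 0
    have hA' : IsUnit (1 + star B * A) := hA
    have hmem : A ∈ unitary (Matrix ι ι K) ↔ star B * A ∈ unitary (Matrix ι ι K) := by
      refine ⟨fun h => mul_mem (Unitary.star_mem hB) h, fun h => ?_⟩
      have := mul_mem hB h
      rwa [← mul_assoc, Unitary.mul_star_self_of_mem hB, one_mul] at this
    rw [cayley_mem_unitary_iff hA', ← hmem]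
    refine and_congr_right fun hAu => ?_
    have hskew := star_cayley_of_mem_unitary hA' (hmem.mp hAu)
    rw [← isSelfAdjoint_mul_cayley_iff hXB.eq (isUnit_one_add_cayley hA') hskew,
      cayley_cayley hA', mul_assoc, ← mul_assoc B, Unitary.mul_star_self_of_mem hB, one_mul]
    rfl

end

/-! ### The critical set -/

section

variable {K : Type*} [NormedDivisionRing K] [NormedAlgebra ℝ K]
variable {ι κ μ : Type*} [Fintype ι] [Fintype κ] [Fintype μ]

omit [Fintype ι] in
theorem hasDerivAt_matrix {f : ℝ → Matrix ι κ K} {f' : Matrix ι κ K} {x : ℝ} :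
    HasDerivAt f f' x ↔ ∀ i j, HasDerivAt (fun s => f s i j) (f' i j) x := by
  refine (hasDerivAt_pi (φ := fun y i => f y i)).trans (forall_congr' fun i => ?_)
  exact hasDerivAt_pi (φ := fun y j => f y i j)

omit [Fintype ι] in
theorem HasDerivAt.matrix_mul {f : ℝ → Matrix ι κ K} {g : ℝ → Matrix κ μ K} {f' : Matrix ι κ K}
    {g' : Matrix κ μ K} {x : ℝ} (hf : HasDerivAt f f' x) (hg : HasDerivAt g g' x) :
    HasDerivAt (fun s => f s * g s) (f' * g x + f x * g') x := by
  rw [hasDerivAt_matrix] at *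
  intro i j
  simp only [Matrix.mul_apply, Matrix.add_apply, ← Finset.sum_add_distrib]
  exact HasDerivAt.fun_sum fun l _ => (hf i l).mul (hg l j)

theorem HasDerivAt.conjTranspose [StarRing K] [StarModule ℝ K] [FiniteDimensional ℝ K]
    {f : ℝ → Matrix ι κ K} {f' : Matrix ι κ K} {x : ℝ} (hf : HasDerivAt f f' x) :
    HasDerivAt (fun s => (f s)ᴴ) f'ᴴ x := by
  rw [hasDerivAt_matrix] at *
  intro i j
  exact ((starLinearEquiv ℝ (A := K)).toLinearMap.toContinuousLinearMap.hasFDerivAt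
    (x := f x j i)).comp_hasDerivAt x (hf j i)

variable [FiniteDimensional ℝ K]

theorem HasDerivAt.re_trace (re : K →ₗ[ℝ] ℝ) {f : ℝ → Matrix ι ι K} {f' : Matrix ι ι K} {x : ℝ}
    (hf : HasDerivAt f f' x) : HasDerivAt (fun s => re (f s).trace) (re f'.trace) x := by
  rw [hasDerivAt_matrix] at hf
  simp only [Matrix.trace, Matrix.diag, map_sum]
  refine HasDerivAt.fun_sum fun i _ => ?_
  exact (re.toContinuousLinearMap.hasFDerivAt (x := f x i i)).comp_hasDerivAt x (hf i i)

/-- The derivative is read off from `cayley (s • Z) * (1 + s • Z) = 1 - s • Z`. -/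
theorem hasDerivAt_cayley_smul [DecidableEq ι] (Z : Matrix ι ι K) :
    HasDerivAt (fun s : ℝ => cayley (s • Z)) (-Z - Z) 0 := by
  have hlin : ContDiff ℝ 1 fun s : ℝ => s • Z := contDiff_id.smul contDiff_const
  have hd := ((hlin.contDiffAt (x := 0)).cayley (by simp)).differentiableAt
    one_ne_zero |>.hasDerivAt
  have hs : HasDerivAt (fun s : ℝ => s • Z) Z 0 := by
    refine hasDerivAt_matrix.mpr fun i j => ?_
    simpa using (hasDerivAt_id (0 : ℝ)).smul_const (Z i j)
  have h1 := hd.matrix_mul (hs.const_add 1)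
  have h2 : HasDerivAt (fun s : ℝ => cayley (s • Z) * (1 + s • Z)) (-Z) 0 := by
    refine (hs.const_sub 1).congr_of_eventuallyEq ?_
    have hopen : ∀ᶠ s : ℝ in 𝓝 0, IsUnit (1 + s • Z) := by
      refine (isOpen_isUnit_matrix.preimage
        (contDiff_const.add hlin).continuous).mem_nhds ?_
      simp
    filter_upwards [hopen] with s hs
    exact cayley_mul_one_add hs
  have h3 := h1.unique h2
  simp only [zero_smul, cayley_zero, add_zero, mul_one, one_mul] at h3
  rw [← eq_sub_iff_add_eq] at h3
  rw [← h3]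
  exact hd

end

section

variable {K : Type} [NormedDivisionRing K] [NormedAlgebra ℝ K] [FiniteDimensional ℝ K] [StarRing K]
  [StarModule ℝ K] {re : K →ₗ[ℝ] ℝ} {n : ℕ}

omit [StarModule ℝ K] in
theorem IsRealPart.isUnit_one_add_of_skew (hre : IsRealPart re) {Z : Matrix (Fin n) (Fin n) K}
    (hZ : Zᴴ = -Z) : IsUnit (1 + Z) :=
  isUnit_of_mulVec_injective fun _ => hre.eq_zero_of_mulVec_one_add hZ

omit [StarModule ℝ K] in
theorem hasDerivAt_heightFunction (re : K →ₗ[ℝ] ℝ) (X : Matrix (Fin n) (Fin n) K)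
    {γ : ℝ → OGroup K n} {D : Matrix (Fin n) (Fin n) K} {x : ℝ}
    (hD : HasDerivAt (fun s => (γ s : Matrix (Fin n) (Fin n) K)) D x) :
    HasDerivAt (fun s => heightFunction re X (γ s)) (re (Xᴴ * D).trace) x := by
  have h := ((hasDerivAt_const x Xᴴ).matrix_mul hD).re_trace re
  rw [Matrix.zero_mul, zero_add] at h
  exact h

/-- The curves `s ↦ A * cayley (s • Z)` through `A`, with velocity `-2 A Z`, test a critical point
against all skew-Hermitian `Z`. -/
theorem IsRealPart.isHermitian_of_mem_criticalSet (hre : IsRealPart re)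
    {X : Matrix (Fin n) (Fin n) K} {A : OGroup K n}
    (hA : A ∈ criticalSet (heightFunction re X)) :
    (Xᴴ * (A : Matrix (Fin n) (Fin n) K)).IsHermitian := by
  refine hre.isHermitian_of_re_trace_mul_eq_zero fun Z hZ => ?_
  have hsZ : ∀ s : ℝ, (s • Z)ᴴ = -(s • Z) := fun s => by
    rw [Matrix.conjTranspose_smul, hZ, star_trivial, smul_neg]
  have hu := fun s => hre.isUnit_one_add_of_skew (hsZ s)
  let γ : ℝ → OGroup K n := fun s =>
    ⟨A * cayley (s • Z), mul_mem A.2 (cayley_mem_unitary (hu s) (hsZ s))⟩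
  have hγ : ContDiff ℝ ∞ fun s => (γ s : Matrix (Fin n) (Fin n) K) := by
    have hlin : ContDiff ℝ ∞ fun s : ℝ => s • Z := contDiff_id.smul contDiff_const
    have hc : ContDiff ℝ ∞ fun s : ℝ => cayley (s • Z) :=
      contDiff_iff_contDiffAt.mpr fun s => hlin.contDiffAt.cayley (hu s)
    have hAc : ContDiff ℝ ∞ fun s : ℝ => (A : Matrix (Fin n) (Fin n) K) * cayley (s • Z) :=
      contDiff_const.matrix_mul hc
    exact hAc
  have hγ0 : γ 0 = A := by
    apply Subtype.ext
    change (A : Matrix (Fin n) (Fin n) K) * cayley ((0 : ℝ) • Z) = A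
    rw [zero_smul, cayley_zero, mul_one]
  have h1 := hasDerivAt_heightFunction re X (γ := γ)
    ((hasDerivAt_const (0 : ℝ) (A : Matrix (Fin n) (Fin n) K)).matrix_mul
      (hasDerivAt_cayley_smul Z))
  have h2 := h1.unique (hA γ hγ hγ0)
  rw [zero_mul, zero_add, mul_sub, mul_sub, Matrix.trace_sub, map_sub, mul_neg, mul_neg,
    Matrix.trace_neg, map_neg, ← mul_assoc] at h2
  linarith

/-- A curve in `O(n, K)` through `A` has velocity `A * Z` with `Z` skew-Hermitian. -/
theorem IsRealPart.mem_criticalSet_of_isHermitian (hre : IsRealPart re)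
    {X : Matrix (Fin n) (Fin n) K} {A : OGroup K n}
    (hA : (Xᴴ * (A : Matrix (Fin n) (Fin n) K)).IsHermitian) :
    A ∈ criticalSet (heightFunction re X) := by
  intro γ hγ hγ0
  obtain ⟨D, hD⟩ : ∃ D, HasDerivAt (fun s => (γ s : Matrix (Fin n) (Fin n) K)) D 0 :=
    ⟨_, (hγ.differentiable (by simp) 0).hasDerivAt⟩
  have hskew : star (A : Matrix (Fin n) (Fin n) K) * D =
      -(star (star (A : Matrix (Fin n) (Fin n) K) * D)) := by
    have h1 := hD.conjTranspose.matrix_mul hD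
    have h2 : (fun s => (γ s : Matrix (Fin n) (Fin n) K)ᴴ * (γ s : Matrix (Fin n) (Fin n) K)) =
        fun _ => 1 := funext fun s => Unitary.coe_star_mul_self (γ s)
    rw [h2] at h1
    have h3 := h1.unique (hasDerivAt_const _ _)
    rw [hγ0] at h3
    rw [star_mul, star_star]
    exact eq_neg_of_add_eq_zero_right h3
  have h0 : re (Xᴴ * D).trace = 0 := by
    have h4 : Xᴴ * D = Xᴴ * (A : Matrix (Fin n) (Fin n) K) *
        (star (A : Matrix (Fin n) (Fin n) K) * D) := by
      rw [mul_assoc, ← mul_assoc (A : Matrix (Fin n) (Fin n) K), 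
        Unitary.mul_star_self_of_mem A.2, one_mul]
    rw [h4]
    exact hre.re_trace_mul_eq_zero hA (neg_eq_iff_eq_neg.mpr hskew).symm
  have h5 := hasDerivAt_heightFunction re X hD
  rwa [h0] at h5

end

/-! ### The singular value decomposition -/

section

variable {K : Type*} [NormedDivisionRing K] [NormedAlgebra ℝ K]
variable {ι : Type*} [Fintype ι] [DecidableEq ι]

/-- The diagonal matrix over `K` with the real entries `d`. -/
noncomputable def realDiagonal (K : Type*) [NormedDivisionRing K] [NormedAlgebra ℝ K] {ι : Type*}
    [DecidableEq ι] (d : ι → ℝ) : Matrix ι ι K :=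
  Matrix.diagonal fun i => algebraMap ℝ K (d i)

theorem realDiagonal_mul_apply (d : ι → ℝ) (M : Matrix ι ι K) (i j : ι) :
    (realDiagonal K d * M) i j = d i • M i j := by
  rw [realDiagonal, Matrix.diagonal_mul, Algebra.smul_def]

theorem mul_realDiagonal_apply (d : ι → ℝ) (M : Matrix ι ι K) (i j : ι) :
    (M * realDiagonal K d) i j = d j • M i j := by
  rw [realDiagonal, Matrix.mul_diagonal, ← Algebra.commutes, Algebra.smul_def]

theorem realDiagonal_mulVec (d : ι → ℝ) (v : ι → K) (i : ι) :
    (realDiagonal K d *ᵥ v) i = d i • v i := by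
  rw [realDiagonal, Matrix.mulVec_diagonal, Algebra.smul_def]

theorem realDiagonal_mul_realDiagonal (d e : ι → ℝ) :
    realDiagonal K d * realDiagonal K e = realDiagonal K fun i => d i * e i := by
  simp [realDiagonal]

omit [Fintype ι] in
theorem realDiagonal_one : realDiagonal K (fun _ : ι => 1) = 1 := by
  simp [realDiagonal]

variable [StarRing K] [StarModule ℝ K]

omit [NormedAlgebra ℝ K] [StarModule ℝ K] in
theorem conjTranspose_mul_self_of_mem {A : Matrix ι ι K} (hA : A ∈ unitary (Matrix ι ι K)) :
    Aᴴ * A = 1 :=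
  Unitary.star_mul_self_of_mem hA

omit [NormedAlgebra ℝ K] [StarModule ℝ K] in
theorem mul_conjTranspose_self_of_mem {A : Matrix ι ι K} (hA : A ∈ unitary (Matrix ι ι K)) :
    A * Aᴴ = 1 :=
  Unitary.mul_star_self_of_mem hA

omit [Fintype ι] in
theorem conjTranspose_realDiagonal (d : ι → ℝ) :
    (realDiagonal K d)ᴴ = realDiagonal K d := by
  rw [realDiagonal, Matrix.diagonal_conjTranspose]
  congr 1
  ext i
  rw [Pi.star_apply, ← algebraMap_star_comm, star_trivial]

theorem realDiagonal_mem_unitary {d : ι → ℝ} (hd : ∀ i, d i * d i = 1) :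
    realDiagonal K d ∈ unitary (Matrix ι ι K) := by
  have h : realDiagonal K d * realDiagonal K d = 1 := by
    rw [realDiagonal_mul_realDiagonal, ← realDiagonal_one]
    congr 1
    ext i
    exact hd i
  rw [Unitary.mem_iff, Matrix.star_eq_conjTranspose, conjTranspose_realDiagonal]
  exact ⟨h, h⟩

theorem IsRealPart.isCompact_unitary [FiniteDimensional ℝ K] {re : K →ₗ[ℝ] ℝ}
    (hre : IsRealPart re) : IsCompact {A : Matrix ι ι K | A ∈ unitary (Matrix ι ι K)} := by
  have : ProperSpace (Matrix ι ι K) := FiniteDimensional.proper ℝ _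
  refine (isCompact_closedBall (0 : Matrix ι ι K) 1).of_isClosed_subset ?_ fun A hA => ?_
  · have h1 : Continuous fun A : Matrix ι ι K => star A * A :=
      (contDiff_conjTranspose.matrix_mul contDiff_id (k := 0)).continuous
    have h2 : Continuous fun A : Matrix ι ι K => A * star A :=
      (contDiff_id.matrix_mul contDiff_conjTranspose (k := 0)).continuous
    simp only [Unitary.mem_iff]
    exact (isClosed_eq h1 continuous_const).inter (isClosed_eq h2 continuous_const)
  · rw [mem_closedBall_zero_iff, Matrix.norm_le_iff zero_le_one]
    exact hre.norm_apply_le_one_of_mem_unitary hA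

end

section

variable {K : Type} [NormedDivisionRing K] [NormedAlgebra ℝ K] [FiniteDimensional ℝ K] [StarRing K]
  [StarModule ℝ K] {re : K →ₗ[ℝ] ℝ} {n : ℕ}

theorem IsRealPart.isHermitian_of_isMax (hre : IsRealPart re) {X : Matrix (Fin n) (Fin n) K}
    {A : Matrix (Fin n) (Fin n) K} (hA : A ∈ unitary (Matrix (Fin n) (Fin n) K))
    (hmax : ∀ B ∈ unitary (Matrix (Fin n) (Fin n) K), re (Xᴴ * B).trace ≤ re (Xᴴ * A).trace) :
    (Xᴴ * A).IsHermitian := by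
  refine hre.isHermitian_of_mem_criticalSet (A := ⟨A, hA⟩) fun γ hγ hγ0 => ?_
  have hd := hasDerivAt_heightFunction re X (γ := γ) (hγ.differentiable (by simp) 0).hasDerivAt
  have hloc : IsLocalMax (fun s => heightFunction re X (γ s)) 0 := by
    refine Filter.Eventually.of_forall fun s => ?_
    simp only [hγ0]
    exact hmax _ (γ s).2
  rwa [hloc.hasDerivAt_eq_zero hd] at hd

omit [FiniteDimensional ℝ K] in
/-- If `N M` and `N M*` are Hermitian for `N = diag(1, …, n)`, then `N ^ 2` commutes with `M`, so
that `M` is diagonal, and the entries of `M` are real. -/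
theorem IsRealPart.eq_realDiagonal_of_isHermitian (hre : IsRealPart re)
    {M : Matrix (Fin n) (Fin n) K}
    (h₁ : (realDiagonal K (fun i : Fin n => (i : ℝ) + 1) * M).IsHermitian)
    (h₂ : (realDiagonal K (fun i : Fin n => (i : ℝ) + 1) * Mᴴ).IsHermitian) :
    M = realDiagonal K fun i => re (M i i) := by
  have e1 : ∀ i j : Fin n, ((i : ℝ) + 1) • M i j = ((j : ℝ) + 1) • star (M j i) := fun i j => by
    have := congrFun (congrFun h₁.eq i) j
    rw [Matrix.conjTranspose_mul, conjTranspose_realDiagonal, mul_realDiagonal_apply,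
      realDiagonal_mul_apply] at this
    exact this.symm
  have e2 : ∀ i j : Fin n, ((i : ℝ) + 1) • star (M j i) = ((j : ℝ) + 1) • M i j := fun i j => by
    have := congrFun (congrFun h₂.eq i) j
    rw [Matrix.conjTranspose_mul, conjTranspose_realDiagonal, mul_realDiagonal_apply,
      realDiagonal_mul_apply, Matrix.conjTranspose_conjTranspose] at this
    exact this.symm
  ext i j
  by_cases hij : i = j
  · subst hij
    rw [realDiagonal, Matrix.diagonal_apply_eq]
    have h0 : (i : ℝ) + 1 ≠ 0 := by positivity
    exact (hre.algebraMap_re _ (smul_right_injective K h0 (e1 i i)).symm).symm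
  · rw [realDiagonal, Matrix.diagonal_apply_ne _ hij]
    have h : (((i : ℝ) + 1) ^ 2 - ((j : ℝ) + 1) ^ 2) • M i j = 0 := by
      rw [sub_smul, sq, sq, mul_smul, mul_smul, e1, smul_comm, e2, sub_self]
    refine (smul_eq_zero.mp h).resolve_left fun h0 => hij ?_
    have h1 : (i : ℝ) + 1 = j + 1 :=
      (sq_eq_sq₀ (by positivity) (by positivity)).mp (sub_eq_zero.mp h0)
    exact Fin.ext (by exact_mod_cast add_right_cancel h1)

omit [StarRing K] [StarModule ℝ K] in
theorem continuous_re_trace (re : K →ₗ[ℝ] ℝ) :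
    Continuous fun A : Matrix (Fin n) (Fin n) K => re A.trace :=
  re.continuous_of_finiteDimensional.comp (continuous_id.matrix_trace)

theorem IsRealPart.exists_max_re_trace (hre : IsRealPart re) (N X : Matrix (Fin n) (Fin n) K) :
    ∃ U ∈ unitary (Matrix (Fin n) (Fin n) K), ∃ V ∈ unitary (Matrix (Fin n) (Fin n) K),
      ∀ U' ∈ unitary (Matrix (Fin n) (Fin n) K), ∀ V' ∈ unitary (Matrix (Fin n) (Fin n) K),
        re (N * U'ᴴ * X * V').trace ≤ re (N * Uᴴ * X * V).trace := by
  have hcomp := hre.isCompact_unitary (ι := Fin n)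
  have hcont : Continuous fun p : Matrix (Fin n) (Fin n) K × Matrix (Fin n) (Fin n) K =>
      N * p.1ᴴ * X * p.2 := by
    have h0 : ContDiff ℝ 0 fun p : Matrix (Fin n) (Fin n) K × Matrix (Fin n) (Fin n) K => p.1ᴴ :=
      contDiff_conjTranspose.comp contDiff_fst
    have h1 : ContDiff ℝ 0 fun p : Matrix (Fin n) (Fin n) K × Matrix (Fin n) (Fin n) K =>
        N * p.1ᴴ * X * p.2 :=
      ((contDiff_const.matrix_mul h0).matrix_mul contDiff_const).matrix_mul contDiff_snd
    exact h1.continuous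
  obtain ⟨p, hp, hmax⟩ := (hcomp.prod hcomp).exists_isMaxOn
    ⟨(1, 1), Set.mk_mem_prod (one_mem (unitary _)) (one_mem (unitary _))⟩
    ((continuous_re_trace re).comp hcont).continuousOn
  refine ⟨p.1, hp.1, p.2, hp.2, fun U hU V hV => ?_⟩
  exact isMaxOn_iff.mp hmax (U, V) (Set.mk_mem_prod hU hV)

/-- The critical point equations of `re (N U* X V).trace` in `V` and in `U`. -/
theorem IsRealPart.exists_unitary_isHermitian (hre : IsRealPart re)
    {N : Matrix (Fin n) (Fin n) K} (hN : Nᴴ = N) (X : Matrix (Fin n) (Fin n) K) :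
    ∃ U ∈ unitary (Matrix (Fin n) (Fin n) K), ∃ V ∈ unitary (Matrix (Fin n) (Fin n) K),
      (N * (Uᴴ * X * V)).IsHermitian ∧ (N * (Uᴴ * X * V)ᴴ).IsHermitian := by
  obtain ⟨U, hU, V, hV, hUV⟩ := hre.exists_max_re_trace N X
  refine ⟨U, hU, V, hV, ?_, ?_⟩
  · have e : (Xᴴ * U * N)ᴴ = N * Uᴴ * X := by
      rw [Matrix.conjTranspose_mul, Matrix.conjTranspose_mul, hN,
        Matrix.conjTranspose_conjTranspose, mul_assoc]
    have h := hre.isHermitian_of_isMax (X := Xᴴ * U * N) hV fun B hB => by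
      rw [e]
      exact hUV U hU B hB
    rwa [e, mul_assoc N, mul_assoc N] at h
  · have hflip : ∀ B : Matrix (Fin n) (Fin n) K,
        re ((X * V * N)ᴴ * B).trace = re (N * Bᴴ * X * V).trace := fun B => by
      rw [← hre.re_trace_conjTranspose, Matrix.conjTranspose_mul,
        Matrix.conjTranspose_conjTranspose, ← mul_assoc, hre.re_trace_mul_comm]
      simp only [mul_assoc]
    have h := hre.isHermitian_of_isMax (X := X * V * N) hU fun B hB => by
      rw [hflip, hflip]
      exact hUV B hB V hV
    have e : (X * V * N)ᴴ * U = N * (Uᴴ * X * V)ᴴ := by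
      rw [Matrix.conjTranspose_mul, Matrix.conjTranspose_mul, Matrix.conjTranspose_mul,
        Matrix.conjTranspose_mul, hN, Matrix.conjTranspose_conjTranspose]
      simp only [mul_assoc]
    rwa [e] at h

/-- The singular value decomposition over `ℝ`, `ℂ` and `ℍ`: the unitary `U` and `V` that maximize
`re (N U* X V).trace` for `N = diag(1, …, n)` diagonalize `X`, with real entries, whose signs can
be moved into `U`. -/
theorem IsRealPart.exists_svd (hre : IsRealPart re) (X : Matrix (Fin n) (Fin n) K) :
    ∃ U ∈ unitary (Matrix (Fin n) (Fin n) K), ∃ V ∈ unitary (Matrix (Fin n) (Fin n) K),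
      ∃ d : Fin n → ℝ, (∀ i, 0 ≤ d i) ∧ X = U * realDiagonal K d * Vᴴ := by
  obtain ⟨U, hU, V, hV, h₁, h₂⟩ := hre.exists_unitary_isHermitian
    (conjTranspose_realDiagonal fun i : Fin n => (i : ℝ) + 1) X
  have hM := hre.eq_realDiagonal_of_isHermitian h₁ h₂
  have hX : X = U * (Uᴴ * X * V) * Vᴴ := by
    have e1 := mul_conjTranspose_self_of_mem hU
    have e2 := mul_conjTranspose_self_of_mem hV
    calc X = (U * Uᴴ) * X * (V * Vᴴ) := by rw [e1, e2, one_mul, mul_one]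
      _ = U * (Uᴴ * X * V) * Vᴴ := by simp only [mul_assoc]
  generalize (fun i => re ((Uᴴ * X * V) i i)) = r at hM
  rw [hM] at hX
  let ε : Fin n → ℝ := fun i => if 0 ≤ r i then 1 else -1
  have hε : ∀ i, ε i * ε i = 1 := fun i => by
    by_cases h : 0 ≤ r i <;> simp [ε, h]
  have hr : ∀ i, r i = ε i * |r i| := fun i => by
    by_cases h : 0 ≤ r i
    · simp [ε, h, abs_of_nonneg h]
    · simp [ε, h, abs_of_neg (not_le.mp h)]
  refine ⟨U * realDiagonal K ε, mul_mem hU (realDiagonal_mem_unitary hε), V, hV,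
    fun i => |r i|, fun i => abs_nonneg _, ?_⟩
  rw [mul_assoc U, realDiagonal_mul_realDiagonal, ← funext hr]
  exact hX

end

/-! ### Multiplicities of singular values -/

section

variable {K : Type} [NormedDivisionRing K] [NormedAlgebra ℝ K] [StarRing K] [StarModule ℝ K]
variable {n : ℕ} {X U V : Matrix (Fin n) (Fin n) K} {d : Fin n → ℝ}

theorem mem_singularSubspace_iff_of_svd (hU : U ∈ unitary (Matrix (Fin n) (Fin n) K))
    (hV : V ∈ unitary (Matrix (Fin n) (Fin n) K)) (hd : ∀ i, 0 ≤ d i)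
    (hX : X = U * realDiagonal K d * Vᴴ) {t : ℝ} (ht : 0 ≤ t) (v : Fin n → K) :
    v ∈ singularSubspace X t ↔ ∀ i, d i ≠ t → (Vᴴ *ᵥ v) i = 0 := by
  have hVV := conjTranspose_mul_self_of_mem hV
  have hVV' := mul_conjTranspose_self_of_mem hV
  have hUU := conjTranspose_mul_self_of_mem hU
  have hXX : Xᴴ * X = V * realDiagonal K (fun i => d i * d i) * Vᴴ := by
    rw [hX, Matrix.conjTranspose_mul, Matrix.conjTranspose_mul, conjTranspose_realDiagonal,
      Matrix.conjTranspose_conjTranspose, ← realDiagonal_mul_realDiagonal]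
    calc V * (realDiagonal K d * Uᴴ) * (U * realDiagonal K d * Vᴴ)
        = V * realDiagonal K d * (Uᴴ * U) * realDiagonal K d * Vᴴ := by simp only [mul_assoc]
      _ = V * (realDiagonal K d * realDiagonal K d) * Vᴴ := by
        rw [hUU, mul_one]
        simp only [mul_assoc]
  have h1 : v ∈ singularSubspace X t ↔
      realDiagonal K (fun i => d i * d i) *ᵥ (Vᴴ *ᵥ v) = t ^ 2 • (Vᴴ *ᵥ v) := by
    change (Xᴴ * X) *ᵥ v = t ^ 2 • v ↔ _
    rw [hXX, ← Matrix.mulVec_mulVec, ← Matrix.mulVec_mulVec]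
    constructor
    · intro h
      have := congrArg (Vᴴ *ᵥ ·) h
      simpa only [Matrix.mulVec_mulVec, ← mul_assoc, hVV, one_mul, Matrix.mulVec_smul] using this
    · intro h
      rw [h, Matrix.mulVec_smul, Matrix.mulVec_mulVec, hVV', Matrix.one_mulVec]
  rw [h1, funext_iff]
  refine forall_congr' fun i => ?_
  rw [realDiagonal_mulVec, Pi.smul_apply, ← sub_eq_zero, ← sub_smul, smul_eq_zero, sub_eq_zero,
    ← sq, sq_eq_sq₀ (hd i) ht, or_iff_not_imp_left]

/-- The eigenspace of `X* X` for `t ^ 2` in the coordinates of a singular value decomposition. The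
coordinates are taken in `Kᵐᵒᵖ`, over which `K` is free of rank one. -/
noncomputable def singularSubspaceEquiv (hU : U ∈ unitary (Matrix (Fin n) (Fin n) K))
    (hV : V ∈ unitary (Matrix (Fin n) (Fin n) K)) (hd : ∀ i, 0 ≤ d i)
    (hX : X = U * realDiagonal K d * Vᴴ) {t : ℝ} (ht : 0 ≤ t) :
    singularSubspace X t ≃ₗ[Kᵐᵒᵖ] ({i // d i = t} → Kᵐᵒᵖ) where
  toFun v i := MulOpposite.op ((Vᴴ *ᵥ (v : Fin n → K)) i)
  map_add' v w := by
    ext i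
    simp [Matrix.mulVec_add]
  map_smul' c v := by
    ext i
    simp [Matrix.mulVec_smul]
  invFun w := ⟨V *ᵥ fun i => if h : d i = t then (w ⟨i, h⟩).unop else 0, by
    rw [mem_singularSubspace_iff_of_svd hU hV hd hX ht, Matrix.mulVec_mulVec]
    intro i hi
    rw [conjTranspose_mul_self_of_mem hV, Matrix.one_mulVec, dif_neg hi]⟩
  left_inv v := by
    have hv := (mem_singularSubspace_iff_of_svd hU hV hd hX ht v.1).mp v.2
    have h : (fun i => if d i = t then (Vᴴ *ᵥ (v : Fin n → K)) i else 0) = Vᴴ *ᵥ v.1 := by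
      ext i
      by_cases hi : d i = t
      · rw [if_pos hi]
      · rw [if_neg hi, hv i hi]
    apply Subtype.ext
    simp only [MulOpposite.unop_op, dite_eq_ite]
    rw [h, Matrix.mulVec_mulVec, mul_conjTranspose_self_of_mem hV,
      Matrix.one_mulVec]
  right_inv w := by
    ext i
    simp only
    rw [Matrix.mulVec_mulVec, conjTranspose_mul_self_of_mem hV, Matrix.one_mulVec,
      dif_pos i.2]
    rfl

theorem singularMultiplicity_eq_card (hU : U ∈ unitary (Matrix (Fin n) (Fin n) K))
    (hV : V ∈ unitary (Matrix (Fin n) (Fin n) K)) (hd : ∀ i, 0 ≤ d i)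
    (hX : X = U * realDiagonal K d * Vᴴ) {t : ℝ} (ht : 0 ≤ t) :
    singularMultiplicity X t = Fintype.card {i // d i = t} := by
  rw [singularMultiplicity, (singularSubspaceEquiv hU hV hd hX ht).finrank_eq,
    Module.finrank_fintype_fun_eq_card]

theorem isSingularValue_of_svd (hU : U ∈ unitary (Matrix (Fin n) (Fin n) K))
    (hV : V ∈ unitary (Matrix (Fin n) (Fin n) K)) (hd : ∀ i, 0 ≤ d i)
    (hX : X = U * realDiagonal K d * Vᴴ) (i : Fin n) : IsSingularValue X (d i) := by
  refine ⟨hd i, fun h => ?_⟩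
  have h1 := singularMultiplicity_eq_card hU hV hd hX (hd i)
  rw [singularMultiplicity, h, finrank_bot, eq_comm, Fintype.card_eq_zero_iff] at h1
  exact h1.elim ⟨i, rfl⟩

theorem injective_option_elim_zero {k : ℕ} {t : Fin k → ℝ} (htpos : ∀ q, 0 < t q)
    (htinj : Function.Injective t) : Function.Injective fun o : Option (Fin k) => o.elim 0 t := by
  rintro (_ | q) (_ | r) h
  · rfl
  · exact absurd h (htpos r).ne
  · exact absurd h (htpos q).ne'
  · exact congrArg some (htinj h)

/-- The diagonal positions of a singular value decomposition, grouped by singular value; `none`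
stands for the singular value `0`. -/
theorem exists_equiv_singular_values (hU : U ∈ unitary (Matrix (Fin n) (Fin n) K))
    (hV : V ∈ unitary (Matrix (Fin n) (Fin n) K)) (hd : ∀ i, 0 ≤ d i)
    (hX : X = U * realDiagonal K d * Vᴴ) {k : ℕ} {t : Fin k → ℝ} (ht : StrictMono t)
    (ht_range : Set.range t = {s : ℝ | 0 < s ∧ IsSingularValue X s}) :
    ∃ e : (Σ o : Option (Fin k), Fin (o.elim (singularMultiplicity X 0)
        fun q => singularMultiplicity X (t q))) ≃ Fin n,
      ∀ o i, d (e ⟨o, i⟩) = o.elim 0 t := by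
  have htpos : ∀ q, 0 < t q := fun q => (ht_range ▸ Set.mem_range_self q : t q ∈ {s | _}).1
  have hf : ∀ i, ∃ o : Option (Fin k), o.elim 0 t = d i := fun i => by
    rcases (hd i).eq_or_lt with h | h
    · exact ⟨none, h⟩
    · obtain ⟨q, hq⟩ : d i ∈ Set.range t := by
        rw [ht_range]
        exact ⟨h, isSingularValue_of_svd hU hV hd hX i⟩
      exact ⟨some q, hq⟩
  have hinj := injective_option_elim_zero htpos ht.injective
  choose f hf using hf
  have hcard : ∀ o : Option (Fin k), o.elim (singularMultiplicity X 0)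
      (fun q => singularMultiplicity X (t q)) = Fintype.card {i // f i = o} := fun o => by
    have h1 : o.elim (singularMultiplicity X 0) (fun q => singularMultiplicity X (t q)) =
        singularMultiplicity X (o.elim 0 t) := by cases o <;> rfl
    have h2 : 0 ≤ o.elim 0 t := by
      rcases o with _ | q
      · exact le_rfl
      · exact (htpos q).le
    rw [h1, singularMultiplicity_eq_card hU hV hd hX h2]
    refine Fintype.card_congr (Equiv.subtypeEquivRight fun i => ?_)
    rw [← hf i]
    exact hinj.eq_iff
  refine ⟨(Equiv.sigmaCongrRight fun o => ?_).trans (Equiv.sigmaFiberEquiv f), ?_⟩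
  · exact (finCongr (hcard o)).trans (Fintype.equivFin _).symm
  · intro o i
    rw [← hf]
    congr 1
    exact ((finCongr (hcard o)).trans (Fintype.equivFin {i // f i = o}).symm i).2

end

/-! ### Diffeomorphisms -/

section

open Diffeology

variable {M N P Q : Type*} [DiffeologicalSpace M] [DiffeologicalSpace N] [DiffeologicalSpace P]
  [DiffeologicalSpace Q]

def SmoothEquiv.refl (M : Type*) [DiffeologicalSpace M] : SmoothEquiv M M where
  toEquiv := Equiv.refl M
  smooth_toFun := dSmooth_id
  smooth_invFun := dSmooth_id

def SmoothEquiv.trans (f : SmoothEquiv M N) (g : SmoothEquiv N P) : SmoothEquiv M P where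
  toEquiv := f.toEquiv.trans g.toEquiv
  smooth_toFun := g.smooth_toFun.comp f.smooth_toFun
  smooth_invFun := f.smooth_invFun.comp g.smooth_invFun

def SmoothEquiv.prodCongr (f : SmoothEquiv M N) (g : SmoothEquiv P Q) :
    SmoothEquiv (M × P) (N × Q) where
  toEquiv := f.toEquiv.prodCongr g.toEquiv
  smooth_toFun _ _ hp := ⟨f.smooth_toFun _ _ hp.1, g.smooth_toFun _ _ hp.2⟩
  smooth_invFun _ _ hp := ⟨f.smooth_invFun _ _ hp.1, g.smooth_invFun _ _ hp.2⟩

def SmoothEquiv.piCongrRight {ι : Type*} {M N : ι → Type*} [∀ i, DiffeologicalSpace (M i)]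
    [∀ i, DiffeologicalSpace (N i)] (f : ∀ i, SmoothEquiv (M i) (N i)) :
    SmoothEquiv (∀ i, M i) (∀ i, N i) where
  toEquiv := Equiv.piCongrRight fun i => (f i).toEquiv
  smooth_toFun _ _ hp i := (f i).smooth_toFun _ _ (hp i)
  smooth_invFun _ _ hp i := (f i).smooth_invFun _ _ (hp i)

end

/-! ### The block decomposition of the critical set -/

section

variable {K : Type} [NormedDivisionRing K] [NormedAlgebra ℝ K] [StarRing K]

/-- The unitary matrices that are Hermitian, i.e. the involutions in `O(p, K)`. -/
abbrev HermitianUnitary (K : Type) [NormedDivisionRing K] [StarRing K] (p : ℕ) : Type :=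
  {A : OGroup K p // (A : Matrix (Fin p) (Fin p) K).IsHermitian}

variable [StarModule ℝ K]

/-- For unitary `C` and `D = diag(d)` with `d ≥ 0`, the equation `D C = C* D` says that `C` is
block diagonal for the partition into the levels of `d`, with Hermitian blocks at the nonzero
levels. -/
theorem isHermitian_realDiagonal_mul_iff {ι : Type*} [Fintype ι] [DecidableEq ι] {d : ι → ℝ}
    (hd : ∀ i, 0 ≤ d i) {C : Matrix ι ι K} (hC : C ∈ unitary (Matrix ι ι K)) :
    (realDiagonal K d * C).IsHermitian ↔
      (∀ i j, d i ≠ d j → C i j = 0) ∧ ∀ i j, d i = d j → d i ≠ 0 → star (C j i) = C i j := by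
  have hentry : (realDiagonal K d * C).IsHermitian ↔
      ∀ i j, d j • star (C j i) = d i • C i j := by
    rw [Matrix.IsHermitian, Matrix.conjTranspose_mul, conjTranspose_realDiagonal, ← Matrix.ext_iff]
    simp only [mul_realDiagonal_apply, realDiagonal_mul_apply, Matrix.conjTranspose_apply]
  constructor
  · intro h
    have e1 := hentry.mp h
    have e2 : ∀ i j, d i • star (C j i) = d j • C i j := by
      have hCC := mul_conjTranspose_self_of_mem hC
      have h1 : Cᴴ * realDiagonal K d = realDiagonal K d * C := by
        simpa only [Matrix.IsHermitian, Matrix.conjTranspose_mul, conjTranspose_realDiagonal]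
          using h
      have h2 : realDiagonal K d * Cᴴ = C * realDiagonal K d := by
        calc realDiagonal K d * Cᴴ = C * (Cᴴ * realDiagonal K d) * Cᴴ := by
              rw [← mul_assoc, hCC, one_mul]
          _ = C * realDiagonal K d := by
              rw [h1, mul_assoc, mul_assoc, hCC, mul_one]
      intro i j
      have := congrFun (congrFun h2 i) j
      rwa [realDiagonal_mul_apply, mul_realDiagonal_apply, Matrix.conjTranspose_apply] at this
    refine ⟨fun i j hij => ?_, fun i j hij hi => ?_⟩
    · have h3 : (d i ^ 2 - d j ^ 2) • C i j = 0 := by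
        rw [sub_smul, sq, sq, mul_smul, mul_smul, ← e1, smul_comm, e2, sub_self]
      exact (smul_eq_zero.mp h3).resolve_left fun h0 =>
        hij ((sq_eq_sq₀ (hd i) (hd j)).mp (sub_eq_zero.mp h0))
    · have := e1 i j
      rw [← hij] at this
      exact smul_right_injective K hi this
  · rintro ⟨h0, h1⟩
    refine hentry.mpr fun i j => ?_
    by_cases hij : d i = d j
    · by_cases hi : d i = 0
      · rw [← hij, hi, zero_smul, zero_smul]
      · rw [← hij, h1 i j hij hi]
    · rw [h0 i j hij, h0 j i (Ne.symm hij), star_zero, smul_zero, smul_zero]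

end

section

variable {K : Type} [NormedDivisionRing K] [NormedAlgebra ℝ K] [StarRing K] [StarModule ℝ K]
  {re : K →ₗ[ℝ] ℝ} {n : ℕ} {X U V : Matrix (Fin n) (Fin n) K} {d : Fin n → ℝ}

/-- In the coordinates `C = U* A V` the critical equation for `X = U D V*` becomes the one for
the diagonal matrix `D`. -/
theorem isHermitian_conjTranspose_mul_iff_of_svd (hU : U ∈ unitary (Matrix (Fin n) (Fin n) K))
    (hV : V ∈ unitary (Matrix (Fin n) (Fin n) K))
    (hX : X = U * realDiagonal K d * Vᴴ) (C : Matrix (Fin n) (Fin n) K) :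
    (Xᴴ * (U * C * Vᴴ)).IsHermitian ↔ (realDiagonal K d * C).IsHermitian := by
  have h1 : Xᴴ * (U * C * Vᴴ) = V * (realDiagonal K d * C) * Vᴴ := by
    rw [hX, Matrix.conjTranspose_mul, Matrix.conjTranspose_mul, conjTranspose_realDiagonal,
      Matrix.conjTranspose_conjTranspose]
    calc V * (realDiagonal K d * Uᴴ) * (U * C * Vᴴ)
        = V * (realDiagonal K d * (Uᴴ * U) * C) * Vᴴ := by simp only [mul_assoc]
      _ = V * (realDiagonal K d * C) * Vᴴ := by
        rw [conjTranspose_mul_self_of_mem hU, mul_one]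
  have h2 : realDiagonal K d * C = Vᴴ * (V * (realDiagonal K d * C) * Vᴴ) * V := by
    calc realDiagonal K d * C = (Vᴴ * V) * (realDiagonal K d * C) * (Vᴴ * V) := by
          rw [conjTranspose_mul_self_of_mem hV, one_mul, mul_one]
      _ = _ := by simp only [mul_assoc]
  rw [h1]
  constructor
  · intro h
    rw [h2]
    exact Matrix.isHermitian_conjTranspose_mul_mul V h
  · exact Matrix.isHermitian_mul_mul_conjTranspose V

omit [StarRing K] [StarModule ℝ K] [NormedAlgebra ℝ K] in
theorem contDiff_blockDiagonal' {E O : Type*} [NormedAlgebra ℝ K] [Fintype O] [DecidableEq O]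
    [NormedAddCommGroup E] [NormedSpace ℝ E]
    {M : O → Type*} [∀ o, Fintype (M o)] {k : WithTop ℕ∞} {f : ∀ o, E → Matrix (M o) (M o) K}
    (hf : ∀ o, ContDiff ℝ k (f o)) :
    ContDiff ℝ k fun x => Matrix.blockDiagonal' fun o => f o x := by
  refine contDiff_matrix.mpr ?_
  rintro ⟨o, i⟩ ⟨o', j⟩
  by_cases h : o = o'
  · subst h
    simp only [Matrix.blockDiagonal'_apply_eq]
    exact contDiff_matrix.mp (hf o) i j
  · simp only [Matrix.blockDiagonal'_apply_ne _ _ _ h]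
    exact contDiff_const

variable {k m₀ : ℕ} {m : Fin k → ℕ}

/-- The diagonal blocks of an element of `O(m₀) × ∏ O(m q)`, indexed by `Option (Fin k)`. -/
def blockFamily (B : OGroup K m₀ × ∀ q : Fin k, HermitianUnitary K (m q)) :
    ∀ o : Option (Fin k), OGroup K (o.elim m₀ m)
  | none => B.1
  | some q => (B.2 q).1

/-- The matrix of an element of `O(m₀) × ∏ O(m q)`: block diagonal up to the reindexing `e` and
the unitary factors `U` and `V`. -/
def ofBlocks (U V : Matrix (Fin n) (Fin n) K)
    (e : (Σ o : Option (Fin k), Fin (o.elim m₀ m)) ≃ Fin n)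
    (B : OGroup K m₀ × ∀ q : Fin k, HermitianUnitary K (m q)) : Matrix (Fin n) (Fin n) K :=
  U * (Matrix.blockDiagonal' fun o =>
    (blockFamily B o : Matrix (Fin (o.elim m₀ m)) (Fin (o.elim m₀ m)) K)).submatrix e.symm e.symm
      * Vᴴ

/-- The diagonal block of `U* A V` at the positions labelled `o` by `e`. -/
def toBlock (U V : Matrix (Fin n) (Fin n) K)
    (e : (Σ o : Option (Fin k), Fin (o.elim m₀ m)) ≃ Fin n) (A : Matrix (Fin n) (Fin n) K)
    (o : Option (Fin k)) : Matrix (Fin (o.elim m₀ m)) (Fin (o.elim m₀ m)) K :=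
  (Uᴴ * A * V).submatrix (fun i => e ⟨o, i⟩) (fun i => e ⟨o, i⟩)

variable {e : (Σ o : Option (Fin k), Fin (o.elim m₀ m)) ≃ Fin n} {t : Fin k → ℝ}

section

variable (hU : U ∈ unitary (Matrix (Fin n) (Fin n) K))
  (hV : V ∈ unitary (Matrix (Fin n) (Fin n) K)) (hd : ∀ i, 0 ≤ d i)
  (hX : X = U * realDiagonal K d * Vᴴ) (htpos : ∀ q, 0 < t q) (htinj : Function.Injective t)
  (he : ∀ o i, d (e ⟨o, i⟩) = o.elim 0 t)

include hU hV hd hX htpos htinj he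

theorem submatrix_eq_blockDiagonal' {A : Matrix (Fin n) (Fin n) K}
    (hA : A ∈ unitary (Matrix (Fin n) (Fin n) K)) (hXA : (Xᴴ * A).IsHermitian) :
    (Uᴴ * A * V).submatrix e e = Matrix.blockDiagonal' (toBlock U V e A) ∧
      ∀ q, (toBlock U V e A (some q)).IsHermitian := by
  have hA' : A = U * (Uᴴ * A * V) * Vᴴ := by
    calc A = (U * Uᴴ) * A * (V * Vᴴ) := by
          rw [mul_conjTranspose_self_of_mem hU, mul_conjTranspose_self_of_mem hV, one_mul, mul_one]
      _ = U * (Uᴴ * A * V) * Vᴴ := by simp only [mul_assoc]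
  have hC : Uᴴ * A * V ∈ unitary (Matrix (Fin n) (Fin n) K) :=
    mul_mem (mul_mem (Unitary.star_mem hU) hA) hV
  rw [hA', isHermitian_conjTranspose_mul_iff_of_svd hU hV hX,
    isHermitian_realDiagonal_mul_iff hd hC] at hXA
  constructor
  · ext ⟨o, i⟩ ⟨o', j⟩
    by_cases h : o = o'
    · subst h
      rw [Matrix.blockDiagonal'_apply_eq]
      rfl
    · rw [Matrix.blockDiagonal'_apply_ne _ _ _ h]
      refine hXA.1 _ _ fun h' => h (injective_option_elim_zero htpos htinj ?_)
      rwa [he, he] at h'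
  · intro q
    ext i j
    refine hXA.2 _ _ ?_ ?_
    · rw [he, he]
    · rw [he]
      exact (htpos q).ne'

theorem toBlock_mem_unitary {A : Matrix (Fin n) (Fin n) K}
    (hA : A ∈ unitary (Matrix (Fin n) (Fin n) K)) (hXA : (Xᴴ * A).IsHermitian)
    (o : Option (Fin k)) : toBlock U V e A o ∈ unitary (Matrix _ _ K) := by
  have hC : Uᴴ * A * V ∈ unitary (Matrix (Fin n) (Fin n) K) :=
    mul_mem (mul_mem (Unitary.star_mem hU) hA) hV
  have h := (submatrix_eq_blockDiagonal' hU hV hd hX htpos htinj he hA hXA).1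
  rw [Unitary.mem_iff, Matrix.star_eq_conjTranspose]
  constructor
  · have h1 : Matrix.blockDiagonal' (fun o => (toBlock U V e A o)ᴴ * toBlock U V e A o) =
        Matrix.blockDiagonal' 1 := by
      rw [Matrix.blockDiagonal'_mul, ← Matrix.blockDiagonal'_conjTranspose, ← h,
        Matrix.conjTranspose_submatrix, Matrix.submatrix_mul_equiv,
        conjTranspose_mul_self_of_mem hC, Matrix.submatrix_one_equiv, Matrix.blockDiagonal'_one]
    exact congrFun (Matrix.blockDiagonal'_injective h1) o
  · have h1 : Matrix.blockDiagonal' (fun o => toBlock U V e A o * (toBlock U V e A o)ᴴ) =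
        Matrix.blockDiagonal' 1 := by
      rw [Matrix.blockDiagonal'_mul, ← Matrix.blockDiagonal'_conjTranspose, ← h,
        Matrix.conjTranspose_submatrix, Matrix.submatrix_mul_equiv,
        mul_conjTranspose_self_of_mem hC, Matrix.submatrix_one_equiv, Matrix.blockDiagonal'_one]
    exact congrFun (Matrix.blockDiagonal'_injective h1) o

omit hd hX htpos htinj he [NormedAlgebra ℝ K] [StarModule ℝ K] in
theorem ofBlocks_mem_unitary (B : OGroup K m₀ × ∀ q : Fin k, HermitianUnitary K (m q)) :
    ofBlocks U V e B ∈ unitary (Matrix (Fin n) (Fin n) K) := by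
  refine mul_mem (mul_mem hU ?_) (Unitary.star_mem hV)
  rw [Unitary.mem_iff, Matrix.star_eq_conjTranspose, Matrix.conjTranspose_submatrix,
    Matrix.submatrix_mul_equiv, Matrix.submatrix_mul_equiv, Matrix.blockDiagonal'_conjTranspose,
    ← Matrix.blockDiagonal'_mul, ← Matrix.blockDiagonal'_mul]
  have h1 : (fun o => (blockFamily B o : Matrix (Fin (o.elim m₀ m)) (Fin (o.elim m₀ m)) K)ᴴ *
      (blockFamily B o : Matrix (Fin (o.elim m₀ m)) (Fin (o.elim m₀ m)) K)) = 1 :=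
    funext fun o => conjTranspose_mul_self_of_mem (blockFamily B o).2
  have h2 : (fun o => (blockFamily B o : Matrix (Fin (o.elim m₀ m)) (Fin (o.elim m₀ m)) K) *
      (blockFamily B o : Matrix (Fin (o.elim m₀ m)) (Fin (o.elim m₀ m)) K)ᴴ) = 1 :=
    funext fun o => mul_conjTranspose_self_of_mem (blockFamily B o).2
  rw [h1, h2, Matrix.blockDiagonal'_one, Matrix.submatrix_one_equiv]
  exact ⟨rfl, rfl⟩

theorem isHermitian_conjTranspose_mul_ofBlocks
    (B : OGroup K m₀ × ∀ q : Fin k, HermitianUnitary K (m q)) :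
    (Xᴴ * ofBlocks U V e B).IsHermitian := by
  have hC : (Matrix.blockDiagonal' fun o =>
      (blockFamily B o : Matrix (Fin (o.elim m₀ m)) (Fin (o.elim m₀ m)) K)).submatrix
        e.symm e.symm ∈ unitary (Matrix (Fin n) (Fin n) K) := by
    have := ofBlocks_mem_unitary (U := 1) (V := 1) (e := e) (one_mem _) (one_mem _) B
    simpa only [ofBlocks, Matrix.conjTranspose_one, one_mul, mul_one] using this
  rw [ofBlocks, isHermitian_conjTranspose_mul_iff_of_svd hU hV hX,
    isHermitian_realDiagonal_mul_iff hd hC]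
  constructor
  · intro i j hij
    obtain ⟨⟨o, i⟩, rfl⟩ := e.surjective i
    obtain ⟨⟨o', j⟩, rfl⟩ := e.surjective j
    rw [Matrix.submatrix_apply, e.symm_apply_apply, e.symm_apply_apply,
      Matrix.blockDiagonal'_apply_ne]
    rintro rfl
    exact hij ((he _ _).trans (he _ _).symm)
  · intro i j hij hi
    obtain ⟨⟨o, i⟩, rfl⟩ := e.surjective i
    obtain ⟨⟨o', j⟩, rfl⟩ := e.surjective j
    rw [he, he] at hij
    obtain rfl := injective_option_elim_zero htpos htinj hij
    rw [Matrix.submatrix_apply, Matrix.submatrix_apply, e.symm_apply_apply, e.symm_apply_apply,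
      Matrix.blockDiagonal'_apply_eq, Matrix.blockDiagonal'_apply_eq]
    rcases o with _ | q
    · exact absurd (he none i) hi
    · exact (B.2 q).2.apply i j

end

omit [NormedAlgebra ℝ K] [StarModule ℝ K] in
theorem toBlock_ofBlocks (hU : U ∈ unitary (Matrix (Fin n) (Fin n) K))
    (hV : V ∈ unitary (Matrix (Fin n) (Fin n) K))
    (B : OGroup K m₀ × ∀ q : Fin k, HermitianUnitary K (m q)) (o : Option (Fin k)) :
    toBlock U V e (ofBlocks U V e B) o = blockFamily B o := by
  have h1 : ∀ C : Matrix (Fin n) (Fin n) K, Uᴴ * (U * C * Vᴴ) * V = C := fun C => by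
    calc Uᴴ * (U * C * Vᴴ) * V = (Uᴴ * U) * C * (Vᴴ * V) := by simp only [mul_assoc]
      _ = C := by
        rw [conjTranspose_mul_self_of_mem hU, conjTranspose_mul_self_of_mem hV, one_mul, mul_one]
  ext i j
  rw [toBlock, ofBlocks, h1, Matrix.submatrix_apply, Matrix.submatrix_apply, e.symm_apply_apply,
    e.symm_apply_apply, Matrix.blockDiagonal'_apply_eq]

omit [NormedAlgebra ℝ K] [StarModule ℝ K] in
theorem ofBlocks_eq_of_submatrix_eq (hU : U ∈ unitary (Matrix (Fin n) (Fin n) K))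
    (hV : V ∈ unitary (Matrix (Fin n) (Fin n) K)) {A : Matrix (Fin n) (Fin n) K}
    {B : OGroup K m₀ × ∀ q : Fin k, HermitianUnitary K (m q)}
    (h : (Uᴴ * A * V).submatrix e e = Matrix.blockDiagonal' fun o =>
      (blockFamily B o : Matrix (Fin (o.elim m₀ m)) (Fin (o.elim m₀ m)) K)) :
    ofBlocks U V e B = A := by
  rw [ofBlocks, ← h, Matrix.submatrix_submatrix, e.self_comp_symm, Matrix.submatrix_id_id]
  calc U * (Uᴴ * A * V) * Vᴴ = (U * Uᴴ) * A * (V * Vᴴ) := by simp only [mul_assoc]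
    _ = A := by
      rw [mul_conjTranspose_self_of_mem hU, mul_conjTranspose_self_of_mem hV, one_mul, mul_one]

/-- The critical set of `h_X` in the coordinates of a singular value decomposition of `X`. -/
def IsRealPart.criticalSetEquiv [FiniteDimensional ℝ K] (hre : IsRealPart re)
    (hU : U ∈ unitary (Matrix (Fin n) (Fin n) K))
    (hV : V ∈ unitary (Matrix (Fin n) (Fin n) K)) (hd : ∀ i, 0 ≤ d i)
    (hX : X = U * realDiagonal K d * Vᴴ) (htpos : ∀ q, 0 < t q) (htinj : Function.Injective t)
    (he : ∀ o i, d (e ⟨o, i⟩) = o.elim 0 t) :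
    SmoothEquiv (criticalSet (heightFunction re X))
      (OGroup K m₀ × ∀ q : Fin k, HermitianUnitary K (m q)) where
  toFun A :=
    have hA := hre.isHermitian_of_mem_criticalSet A.2
    (⟨toBlock U V e A.1.1 none,
        toBlock_mem_unitary hU hV hd hX htpos htinj he A.1.2 hA none⟩,
      fun q => ⟨⟨toBlock U V e A.1.1 (some q),
          toBlock_mem_unitary hU hV hd hX htpos htinj he A.1.2 hA (some q)⟩,
        (submatrix_eq_blockDiagonal' hU hV hd hX htpos htinj he A.1.2 hA).2 q⟩)
  invFun B := ⟨⟨ofBlocks U V e B, ofBlocks_mem_unitary hU hV B⟩,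
    hre.mem_criticalSet_of_isHermitian
      (isHermitian_conjTranspose_mul_ofBlocks hU hV hd hX htpos htinj he B)⟩
  left_inv A := by
    apply Subtype.ext
    apply Subtype.ext
    refine ofBlocks_eq_of_submatrix_eq hU hV ?_
    rw [(submatrix_eq_blockDiagonal' hU hV hd hX htpos htinj he A.1.2
      (hre.isHermitian_of_mem_criticalSet A.2)).1]
    congr 1
    ext o : 1
    cases o <;> rfl
  right_inv B := by
    refine Prod.ext ?_ (funext fun q => ?_)
    · exact Subtype.ext (toBlock_ofBlocks hU hV B none)
    · exact Subtype.ext (Subtype.ext (toBlock_ofBlocks hU hV B (some q)))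
  smooth_toFun N p hp := by
    have hp' : ContDiff ℝ ∞ fun x => ((p x : OGroup K n) : Matrix (Fin n) (Fin n) K) := hp
    have h : ∀ o, ContDiff ℝ ∞ fun x => toBlock U V e ((p x : OGroup K n) : Matrix _ _ K) o :=
      fun o => contDiff_matrix.mpr fun i j => contDiff_matrix.mp
        ((contDiff_const.matrix_mul hp').matrix_mul contDiff_const) _ _
    exact ⟨h none, fun q => h (some q)⟩
  smooth_invFun N p hp := by
    have h : ∀ o, ContDiff ℝ ∞ fun x =>
        (blockFamily (p x) o : Matrix (Fin (o.elim m₀ m)) (Fin (o.elim m₀ m)) K)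
      | none => hp.1
      | some q => hp.2 q
    have h1 : ContDiff ℝ ∞ fun x => ofBlocks U V e (p x) :=
      (contDiff_const.matrix_mul (contDiff_matrix.mpr fun i j =>
        contDiff_matrix.mp (contDiff_blockDiagonal' h) _ _)).matrix_mul contDiff_const
    exact h1

end

/-! ### Hermitian unitary matrices and Grassmannians -/

section

variable {K : Type} [NormedDivisionRing K] [NormedAlgebra ℝ K] {p : ℕ}

/-- The signs `1` at the first `q` indices and `-1` at the others. -/
def blockSign (p q : ℕ) (i : Fin p) : ℝ := if (i : ℕ) < q then 1 else -1

theorem blockSign_eq_iff {q : ℕ} {i j : Fin p} :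
    blockSign p q i = blockSign p q j ↔ ((i : ℕ) < q ↔ (j : ℕ) < q) := by
  unfold blockSign
  split_ifs with hi hj hj <;> simp [hi, hj] <;> norm_num

theorem blockSign_mul_self (q : ℕ) (i : Fin p) : blockSign p q i * blockSign p q i = 1 := by
  unfold blockSign
  split_ifs <;> norm_num

theorem sum_blockSign_lt {q r : ℕ} (hqr : q < r) (hr : r ≤ p) :
    ∑ i, blockSign p q i < ∑ i, blockSign p r i := by
  refine Finset.sum_lt_sum (fun i _ => ?_) ⟨⟨q, hqr.trans_le hr⟩, Finset.mem_univ _, ?_⟩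
  · unfold blockSign
    split_ifs <;> first | omega | norm_num
  · simp only [blockSign, lt_irrefl, if_false, hqr, if_true]
    norm_num

/-- Any signs on `p` indices are a permutation of the signs `blockSign p q` for some `q`. -/
theorem exists_perm_blockSign {s : Fin p → ℝ} (hs : ∀ i, s i = 1 ∨ s i = -1) :
    ∃ (q : Fin (p + 1)) (σ : Equiv.Perm (Fin p)), ∀ i, s (σ i) = blockSign p q i := by
  have hle : Fintype.card {i // s i = 1} ≤ p := by
    simpa using Fintype.card_subtype_le fun i => s i = 1
  have hcard : Fintype.card {i : Fin p // (i : ℕ) < Fintype.card {i // s i = 1}} =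
      Fintype.card {i // s i = 1} := by
    rw [Fintype.card_subtype]
    generalize Fintype.card {i // s i = 1} = q at hle
    simpa [hle] using Fin.card_filter_val_lt (m := q) (n := p)
  let e := Fintype.equivOfCardEq hcard
  refine ⟨⟨_, Nat.lt_succ_of_le hle⟩, e.extendSubtype, fun i => ?_⟩
  unfold blockSign
  split_ifs with hi
  · exact e.extendSubtype_mem i hi
  · exact (hs _).resolve_left (e.extendSubtype_not_mem i hi)

variable [StarRing K]

/-- `O(q) × O(p - q)` is the centralizer of the signs `blockSign p q` in `O(p)`. -/
theorem mem_blockSubgroup_iff {q : ℕ} {A : OGroup K p} :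
    A ∈ blockSubgroup K p q ↔ (A : Matrix (Fin p) (Fin p) K) * realDiagonal K (blockSign p q) =
      realDiagonal K (blockSign p q) * A := by
  rw [← Matrix.ext_iff]
  simp only [mul_realDiagonal_apply, realDiagonal_mul_apply]
  refine forall_congr' fun i => forall_congr' fun j => ?_
  rw [← blockSign_eq_iff, ← sub_eq_zero (b := blockSign p q i • _), ← sub_smul, smul_eq_zero,
    sub_eq_zero, or_iff_not_imp_left, eq_comm (a := blockSign p q j)]

theorem conj_realDiagonal_blockSign_eq_iff {q : ℕ} (B C : OGroup K p) :
    (B : Matrix (Fin p) (Fin p) K) * realDiagonal K (blockSign p q) *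
        (B : Matrix (Fin p) (Fin p) K)ᴴ =
      (C : Matrix (Fin p) (Fin p) K) * realDiagonal K (blockSign p q) *
        (C : Matrix (Fin p) (Fin p) K)ᴴ ↔ B⁻¹ * C ∈ blockSubgroup K p q := by
  have hB := conjTranspose_mul_self_of_mem B.2
  have hB' := mul_conjTranspose_self_of_mem B.2
  have hC := conjTranspose_mul_self_of_mem C.2
  have hC' := mul_conjTranspose_self_of_mem C.2
  rw [mem_blockSubgroup_iff]
  change _ ↔ (B : Matrix (Fin p) (Fin p) K)ᴴ * (C : Matrix (Fin p) (Fin p) K) * _ =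
    _ * ((B : Matrix (Fin p) (Fin p) K)ᴴ * (C : Matrix (Fin p) (Fin p) K))
  generalize (B : Matrix (Fin p) (Fin p) K) = B at *
  generalize (C : Matrix (Fin p) (Fin p) K) = C at *
  generalize realDiagonal K (blockSign p q) = S
  constructor
  · intro h
    calc Bᴴ * C * S = Bᴴ * (C * S * Cᴴ) * C := by
          simp only [mul_assoc, hC, mul_one]
      _ = (Bᴴ * B) * S * (Bᴴ * C) := by
          rw [← h]
          simp only [mul_assoc]
      _ = S * (Bᴴ * C) := by rw [hB, one_mul]
  · intro h
    calc B * S * Bᴴ = B * (S * (Bᴴ * C)) * Cᴴ := by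
          simp only [mul_assoc, hC', mul_one]
      _ = (B * Bᴴ) * C * S * Cᴴ := by
          rw [← h]
          simp only [mul_assoc]
      _ = C * S * Cᴴ := by rw [hB', one_mul]

variable [StarModule ℝ K]

theorem conj_realDiagonal_blockSign_mem_unitary (q : ℕ) (B : OGroup K p) :
    (B : Matrix (Fin p) (Fin p) K) * realDiagonal K (blockSign p q) *
        (B : Matrix (Fin p) (Fin p) K)ᴴ ∈ unitary (Matrix (Fin p) (Fin p) K) :=
  mul_mem (mul_mem B.2 (realDiagonal_mem_unitary (blockSign_mul_self q))) (Unitary.star_mem B.2)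

/-- The Hermitian unitary matrix `B diag(1, …, 1, -1, …, -1) B*`, with `q` entries `1`. -/
noncomputable def involution (q : ℕ) (B : OGroup K p) : HermitianUnitary K p :=
  ⟨⟨_, conj_realDiagonal_blockSign_mem_unitary q B⟩,
    Matrix.isHermitian_mul_mul_conjTranspose _ (conjTranspose_realDiagonal _)⟩

theorem involution_eq_iff {q : ℕ} (B C : OGroup K p) :
    involution q B = involution q C ↔ B⁻¹ * C ∈ blockSubgroup K p q := by
  rw [← conj_realDiagonal_blockSign_eq_iff, involution, involution, Subtype.mk.injEq,
    Subtype.mk.injEq]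

/-- A coset in the Grassmannian stands for the involution whose `1`-eigenspace is the span of the
first `q` columns of a representative. -/
noncomputable def grassmannianToInvolution (x : GrassmannianUnion K p) : HermitianUnitary K p :=
  Quotient.liftOn' x.2 (involution (x.1 : ℕ)) fun B C h =>
    (involution_eq_iff B C).mpr (QuotientGroup.leftRel_apply.mp h)

theorem grassmannianToInvolution_mk (q : Fin (p + 1)) (B : OGroup K p) :
    grassmannianToInvolution ⟨q, QuotientGroup.mk B⟩ = involution (q : ℕ) B := rfl

theorem IsRealPart.re_trace_involution {re : K →ₗ[ℝ] ℝ} (hre : IsRealPart re) (q : ℕ)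
    (B : OGroup K p) :
    re ((involution q B).1 : Matrix (Fin p) (Fin p) K).trace = ∑ i, blockSign p q i := by
  change re ((B : Matrix (Fin p) (Fin p) K) * _ * _).trace = _
  rw [hre.re_trace_mul_comm, ← mul_assoc, conjTranspose_mul_self_of_mem B.2, one_mul, realDiagonal,
    Matrix.trace_diagonal, map_sum]
  refine Finset.sum_congr rfl fun i _ => ?_
  rw [Algebra.algebraMap_eq_smul_one, map_smul, hre.re_one, smul_eq_mul, mul_one]

/-- The trace of `B I_q B*` is `2 q - p`, so it determines `q`. -/
theorem IsRealPart.grassmannianToInvolution_injective {re : K →ₗ[ℝ] ℝ} (hre : IsRealPart re) :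
    Function.Injective (grassmannianToInvolution : GrassmannianUnion K p → _) := by
  rintro ⟨q, x⟩ ⟨r, y⟩ h
  obtain ⟨B, rfl⟩ := QuotientGroup.mk_surjective x
  obtain ⟨C, rfl⟩ := QuotientGroup.mk_surjective y
  rw [grassmannianToInvolution_mk, grassmannianToInvolution_mk] at h
  have hqr : q = r := by
    have h1 := hre.re_trace_involution q B
    rw [h, hre.re_trace_involution] at h1
    rcases lt_trichotomy q r with h2 | h2 | h2
    · exact absurd h1 (sum_blockSign_lt h2 (Nat.le_of_lt_succ r.2)).ne'
    · exact h2
    · exact absurd h1 (sum_blockSign_lt h2 (Nat.le_of_lt_succ q.2)).ne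
  subst hqr
  congr 1
  exact QuotientGroup.eq.mpr ((involution_eq_iff B C).mp h)

/-- A Hermitian unitary `A` is `2 P - 1` for the orthogonal projection `P = (1 + A) / 2`, and a
singular value decomposition `P = U D V*` gives `P = P P* = U D ^ 2 U*`. -/
theorem IsRealPart.exists_eq_conj_realDiagonal_sign [FiniteDimensional ℝ K] {re : K →ₗ[ℝ] ℝ}
    (hre : IsRealPart re) {A : Matrix (Fin p) (Fin p) K} (hA : A.IsHermitian) (hAA : A * A = 1) :
    ∃ U ∈ unitary (Matrix (Fin p) (Fin p) K), ∃ s : Fin p → ℝ, (∀ i, s i = 1 ∨ s i = -1) ∧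
      A = U * realDiagonal K s * Uᴴ := by
  obtain ⟨P, hP⟩ : ∃ P : Matrix (Fin p) (Fin p) K, P = (2⁻¹ : ℝ) • (1 + A) := ⟨_, rfl⟩
  have hAP : A = (2 : ℝ) • P - 1 := by
    rw [hP, smul_inv_smul₀ two_ne_zero]
    abel
  have hPh : Pᴴ = P := by
    rw [hP, Matrix.conjTranspose_smul, Matrix.conjTranspose_add, Matrix.conjTranspose_one, hA.eq,
      star_trivial]
  have hPP : P * P = P := by
    have h1 : (1 + A) * (1 + A) = (2 : ℝ) • (1 + A) := by
      rw [mul_add, add_mul, add_mul, hAA, two_smul]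
      simp only [one_mul, mul_one]
      abel
    rw [hP, smul_mul_smul_comm, h1, smul_smul]
    norm_num
  obtain ⟨U, hU, V, hV, d, hd, hX⟩ := hre.exists_svd P
  have hUU := conjTranspose_mul_self_of_mem hU
  have hP2 : P = U * realDiagonal K (fun i => d i * d i) * Uᴴ := by
    calc P = P * Pᴴ := by rw [hPh, hPP]
      _ = U * realDiagonal K d * (Vᴴ * V) * realDiagonal K d * Uᴴ := by
        rw [hX]
        simp only [Matrix.conjTranspose_mul, conjTranspose_realDiagonal,
          Matrix.conjTranspose_conjTranspose, mul_assoc]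
      _ = U * (realDiagonal K d * realDiagonal K d) * Uᴴ := by
        rw [conjTranspose_mul_self_of_mem hV, mul_one]
        simp only [mul_assoc]
      _ = _ := by rw [realDiagonal_mul_realDiagonal]
  have hDD : realDiagonal K (fun i => d i * d i) * realDiagonal K (fun i => d i * d i) =
      realDiagonal K (fun i => d i * d i) := by
    have h1 : realDiagonal K (fun i => d i * d i) = Uᴴ * P * U := by
      rw [hP2]
      calc realDiagonal K (fun i => d i * d i)
          = (Uᴴ * U) * realDiagonal K (fun i => d i * d i) * (Uᴴ * U) := by
            rw [hUU, one_mul, mul_one]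
        _ = _ := by simp only [mul_assoc]
    rw [h1]
    calc Uᴴ * P * U * (Uᴴ * P * U) = Uᴴ * P * (U * Uᴴ) * P * U := by simp only [mul_assoc]
      _ = Uᴴ * P * U := by
        rw [mul_conjTranspose_self_of_mem hU, mul_one, mul_assoc Uᴴ, hPP]
  refine ⟨U, hU, fun i => 2 * (d i * d i) - 1, fun i => ?_, ?_⟩
  · have h1 := congrFun (congrFun hDD i) i
    rw [realDiagonal_mul_realDiagonal, realDiagonal, realDiagonal, Matrix.diagonal_apply_eq,
      Matrix.diagonal_apply_eq] at h1
    have h2 := (algebraMap ℝ K).injective h1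
    rcases mul_eq_zero.mp (show d i * d i * (d i * d i - 1) = 0 by linarith) with h3 | h3
    · right
      change 2 * (d i * d i) - 1 = -1
      linarith
    · left
      linarith
  · have h1 : realDiagonal K (fun i => 2 * (d i * d i) - 1) =
        (2 : ℝ) • realDiagonal K (fun i => d i * d i) - 1 := by
      ext i j
      by_cases hij : i = j
      · subst hij
        rw [Matrix.sub_apply, Matrix.smul_apply, Algebra.smul_def]
        simp [realDiagonal]
      · simp [realDiagonal, hij]
    rw [h1, mul_sub, sub_mul, mul_one, mul_conjTranspose_self_of_mem hU, mul_smul_comm,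
      smul_mul_assoc, ← hP2]
    exact hAP

omit [NormedAlgebra ℝ K] [StarModule ℝ K] in
theorem HermitianUnitary.mul_self (A : HermitianUnitary K p) :
    (A.1 : Matrix (Fin p) (Fin p) K) * (A.1 : Matrix (Fin p) (Fin p) K) = 1 := by
  have h := conjTranspose_mul_self_of_mem A.1.2
  rwa [A.2.eq] at h

theorem IsRealPart.exists_involution_eq [FiniteDimensional ℝ K] {re : K →ₗ[ℝ] ℝ}
    (hre : IsRealPart re) (A : HermitianUnitary K p) :
    ∃ (q : Fin (p + 1)) (B : OGroup K p), involution (q : ℕ) B = A := by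
  obtain ⟨U, hU, s, hs, hA⟩ := hre.exists_eq_conj_realDiagonal_sign A.2 A.mul_self
  obtain ⟨q, σ, hσ⟩ := exists_perm_blockSign hs
  have hB : U.submatrix id σ ∈ unitary (Matrix (Fin p) (Fin p) K) := by
    rw [Unitary.mem_iff, Matrix.star_eq_conjTranspose, Matrix.conjTranspose_submatrix]
    constructor
    · have := Matrix.submatrix_mul_equiv Uᴴ U σ (Equiv.refl _) σ
      rw [Equiv.coe_refl] at this
      rw [this, conjTranspose_mul_self_of_mem hU, Matrix.submatrix_one_equiv]
    · rw [Matrix.submatrix_mul_equiv, mul_conjTranspose_self_of_mem hU, Matrix.submatrix_id_id]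
  refine ⟨q, ⟨_, hB⟩, Subtype.ext (Subtype.ext ?_)⟩
  have hS : realDiagonal K (blockSign p q) = (realDiagonal K s).submatrix σ σ := by
    rw [realDiagonal, realDiagonal, Matrix.submatrix_diagonal_equiv]
    congr 1
    ext i
    rw [Function.comp_apply, hσ]
  change U.submatrix id σ * realDiagonal K (blockSign p q) * (U.submatrix id σ)ᴴ = _
  rw [hS, Matrix.conjTranspose_submatrix, Matrix.submatrix_mul_equiv, Matrix.submatrix_mul_equiv,
    Matrix.submatrix_id_id, ← hA]

theorem IsRealPart.grassmannianToInvolution_bijective [FiniteDimensional ℝ K] {re : K →ₗ[ℝ] ℝ}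
    (hre : IsRealPart re) :
    Function.Bijective (grassmannianToInvolution : GrassmannianUnion K p → _) :=
  ⟨hre.grassmannianToInvolution_injective, fun A => by
    obtain ⟨q, B, h⟩ := hre.exists_involution_eq A
    exact ⟨⟨q, QuotientGroup.mk B⟩, h⟩⟩

end

/-! ### Local square roots of matrices -/

section

variable {K : Type*} [NormedDivisionRing K] [NormedAlgebra ℝ K] [FiniteDimensional ℝ K]
variable {ι : Type*} [Fintype ι] [DecidableEq ι]

omit [FiniteDimensional ℝ K] [DecidableEq ι] in
theorem contDiff_matrix_mul_self {k : WithTop ℕ∞} :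
    ContDiff ℝ k fun W : Matrix ι ι K => W * W :=
  contDiff_id.matrix_mul contDiff_id

/-- Multiplication by `2` on matrices, the derivative of `W ↦ W * W` at `1`. -/
noncomputable def twoSMulEquiv (K ι : Type*) [NormedDivisionRing K] [NormedAlgebra ℝ K]
    [FiniteDimensional ℝ K] [Fintype ι] : Matrix ι ι K ≃L[ℝ] Matrix ι ι K :=
  (LinearEquiv.smulOfNeZero ℝ (Matrix ι ι K) (2 : ℝ) two_ne_zero).toContinuousLinearEquiv

theorem hasFDerivAt_matrix_mul_self_one :
    HasFDerivAt (fun W : Matrix ι ι K => W * W)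
      (twoSMulEquiv K ι : Matrix ι ι K →L[ℝ] Matrix ι ι K) 1 := by
  have h := ((contDiff_matrix_mul_self (K := K) (ι := ι) (k := 1)).differentiable
    one_ne_zero 1).hasFDerivAt
  have h2 : fderiv ℝ (fun W : Matrix ι ι K => W * W) 1 =
      (twoSMulEquiv K ι : Matrix ι ι K →L[ℝ] Matrix ι ι K) := by
    ext V : 1
    have hl : HasDerivAt (fun s : ℝ => 1 + s • V) V 0 := by
      refine hasDerivAt_matrix.mpr fun i j => ?_
      simpa using ((hasDerivAt_id (0 : ℝ)).smul_const (V i j)).const_add ((1 : Matrix ι ι K) i j)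
    have h0 : (1 : Matrix ι ι K) = 1 + (0 : ℝ) • V := by simp
    rw [h0] at h
    have hcomp : HasDerivAt (fun s : ℝ => (1 + s • V) * (1 + s • V))
        (fderiv ℝ (fun W : Matrix ι ι K => W * W) (1 + (0 : ℝ) • V) V) 0 :=
      HasFDerivAt.comp_hasDerivAt (l := fun W : Matrix ι ι K => W * W) (0 : ℝ) h hl
    have h3 := hcomp.unique (hl.matrix_mul hl)
    rw [← h0] at h3
    rw [h3]
    simp only [mul_one, one_mul]
    exact (two_smul ℝ V).symm
  rw [← h2]
  exact h

/-- The inverse function theorem for `W ↦ W * W` at `1`. The inverse is analytic at `1`, hence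
smooth in a neighbourhood. -/
theorem exists_local_sqrt :
    ∃ f : Matrix ι ι K → Matrix ι ι K, f 1 = 1 ∧ (∀ᶠ W in 𝓝 1, ContDiffAt ℝ ∞ f W) ∧
      (∀ᶠ W in 𝓝 1, f W * f W = W) ∧
      ∃ S ∈ 𝓝 (1 : Matrix ι ι K), ∀ A ∈ S, ∀ B ∈ S, A * A = B * B → A = B := by
  have hc : ContDiffAt ℝ ω (fun W : Matrix ι ι K => W * W) 1 :=
    contDiff_matrix_mul_self.contDiffAt
  have hω : (ω : WithTop ℕ∞) ≠ 0 := by simp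
  let e := hc.toOpenPartialHomeomorph _ hasFDerivAt_matrix_mul_self_one hω
  have h1 : (1 : Matrix ι ι K) ∈ e.source :=
    hc.mem_toOpenPartialHomeomorph_source hasFDerivAt_matrix_mul_self_one hω
  have he1 : e 1 = 1 := mul_one 1
  have h1' : (1 : Matrix ι ι K) ∈ e.target := he1 ▸ e.map_source h1
  have hs := hc.to_localInverse hasFDerivAt_matrix_mul_self_one hω
  refine ⟨e.symm, ?_, ?_, ?_, e.source, e.open_source.mem_nhds h1,
    fun A hA B hB h => e.injOn hA hB h⟩
  · rw [← he1, e.left_inv h1, he1]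
  · have h2 : ContDiffAt ℝ ω e.symm 1 := by
      rw [mul_one] at hs
      exact hs
    filter_upwards [h2.eventually (by simp)] with W hW
    exact hW.of_le (by simp)
  · filter_upwards [e.open_target.mem_nhds h1'] with W hW
    exact e.right_inv hW

end

/-! ### Smooth families of involutions -/

section

open Diffeology

variable {K : Type} [NormedDivisionRing K] [NormedAlgebra ℝ K] [FiniteDimensional ℝ K] [StarRing K]
  [StarModule ℝ K] {p : ℕ}

/-- Near a Hermitian unitary matrix `A₀` every Hermitian unitary matrix `A` is `R A₀ R*` with `R`
unitary and depending smoothly on `A`: take for `R*` the square root of `A₀ A` that is close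
to `1`. -/
theorem exists_local_conjugation (A₀ : HermitianUnitary K p) :
    ∃ f : Matrix (Fin p) (Fin p) K → Matrix (Fin p) (Fin p) K,
      ∀ᶠ A in 𝓝 (A₀.1 : Matrix (Fin p) (Fin p) K), ContDiffAt ℝ ∞ f A ∧
        (A.IsHermitian → A ∈ unitary (Matrix (Fin p) (Fin p) K) →
          f A ∈ unitary (Matrix (Fin p) (Fin p) K) ∧ A = f A * A₀.1 * (f A)ᴴ) := by
  obtain ⟨g, hg1, hgs, hgg, S, hS, hSinj⟩ := exists_local_sqrt (K := K) (ι := Fin p)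
  have h00 := A₀.mul_self
  have h0h := A₀.2.eq
  generalize (A₀.1 : Matrix (Fin p) (Fin p) K) = A₀ at *
  have hW : ContDiff ℝ ∞ fun A : Matrix (Fin p) (Fin p) K => A₀ * A :=
    contDiff_const.matrix_mul contDiff_id
  have hWt : Filter.Tendsto (fun A : Matrix (Fin p) (Fin p) K => A₀ * A) (𝓝 A₀) (𝓝 1) := by
    have := hW.continuous.tendsto A₀
    rwa [h00] at this
  have hgt : Filter.Tendsto g (𝓝 1) (𝓝 1) := by
    have := hgs.self_of_nhds.continuousAt.tendsto
    rwa [hg1] at this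
  have hstar : Filter.Tendsto (fun R : Matrix (Fin p) (Fin p) K => Rᴴ) (𝓝 1) (𝓝 1) := by
    have := (contDiff_conjTranspose (K := K) (ι := Fin p) (κ := Fin p)
      (k := 0)).continuous.tendsto 1
    rwa [Matrix.conjTranspose_one] at this
  have hconj : Filter.Tendsto (fun R : Matrix (Fin p) (Fin p) K => A₀ * R * A₀) (𝓝 1) (𝓝 1) := by
    have h1 : ContDiff ℝ 0 fun R : Matrix (Fin p) (Fin p) K => A₀ * R * A₀ :=
      (contDiff_const.matrix_mul contDiff_id).matrix_mul contDiff_const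
    have := h1.continuous.tendsto 1
    rwa [mul_one, h00] at this
  have hinv : Filter.Tendsto (Ring.inverse : Matrix (Fin p) (Fin p) K → _) (𝓝 1) (𝓝 1) := by
    have := (contDiffAt_matrix_ringInverse (k := 0)
      (isUnit_one (M := Matrix (Fin p) (Fin p) K))).continuousAt.tendsto
    rwa [Ring.inverse_one] at this
  have hunit : ∀ᶠ R in 𝓝 (1 : Matrix (Fin p) (Fin p) K), IsUnit R :=
    isOpen_isUnit_matrix.mem_nhds isUnit_one
  refine ⟨fun A => (g (A₀ * A))ᴴ, ?_⟩
  have hgW := hgt.comp hWt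
  filter_upwards [hWt.eventually hgs, hWt.eventually hgg, hgW.eventually hunit,
    hgW.eventually (hstar hS), hgW.eventually (hconj hS), hgW.eventually (hinv hS)]
    with A h1 h2 h3 h4 h5 h6
  refine ⟨?_, fun hA hAu => ?_⟩
  · have h7 : ContDiffAt ℝ ∞ (fun A => g (A₀ * A)) A :=
      ContDiffAt.comp (g := g) A h1 hW.contDiffAt
    exact ContDiffAt.comp (g := Matrix.conjTranspose) A contDiff_conjTranspose.contDiffAt h7
  have hAA : A * A = 1 := by
    have := conjTranspose_mul_self_of_mem hAu
    rwa [hA.eq] at this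
  simp only [Function.comp_apply] at h3 h4 h5 h6
  change g (A₀ * A) ∈ (fun R => Rᴴ) ⁻¹' S at h4
  change g (A₀ * A) ∈ (fun R => A₀ * R * A₀) ⁻¹' S at h5
  change g (A₀ * A) ∈ Ring.inverse ⁻¹' S at h6
  generalize g (A₀ * A) = R at *
  have hRR : Rᴴ * Rᴴ = A * A₀ := by
    rw [← Matrix.conjTranspose_mul, h2, Matrix.conjTranspose_mul, hA.eq, h0h]
  -- `R*`, `A₀ R A₀` and `R⁻¹` are square roots near `1` of the same matrix `A A₀`.
  have e1 : Rᴴ = A₀ * R * A₀ := by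
    refine hSinj _ h4 _ h5 ?_
    rw [hRR]
    calc A * A₀ = A₀ * (A₀ * A) * A₀ := by rw [← mul_assoc A₀, h00, one_mul]
      _ = A₀ * R * (A₀ * A₀) * R * A₀ := by
        rw [← h2, h00, mul_one]
        simp only [mul_assoc]
      _ = _ := by simp only [mul_assoc]
  have e2 : Rᴴ = Ring.inverse R := by
    refine hSinj _ h4 _ h6 ?_
    rw [hRR, ← Ring.inverse_mul (Or.inl h3), h2]
    have hu : IsUnit (A₀ * A) := h2 ▸ h3.mul h3
    rw [eq_comm, ← mul_one (Ring.inverse _), Ring.inverse_mul_eq_iff_eq_mul _ _ _ hu, mul_assoc,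
      ← mul_assoc A, hAA, one_mul, h00]
  have hR1 : Rᴴ * R = 1 := by rw [e2, Ring.inverse_mul_cancel _ h3]
  have hR2 : R * Rᴴ = 1 := by rw [e2, Ring.mul_inverse_cancel _ h3]
  refine ⟨?_, ?_⟩
  · rw [Unitary.mem_iff, Matrix.star_eq_conjTranspose, Matrix.conjTranspose_conjTranspose]
    exact ⟨hR2, hR1⟩
  · rw [Matrix.conjTranspose_conjTranspose]
    calc A = A₀ * (R * R) := by rw [h2, ← mul_assoc, h00, one_mul]
      _ = A₀ * R * (A₀ * A₀) * R := by
        rw [h00, mul_one]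
        simp only [mul_assoc]
      _ = Rᴴ * A₀ * R := by
        rw [e1]
        simp only [mul_assoc]

theorem contDiff_involution {E : Type*} [NormedAddCommGroup E] [NormedSpace ℝ E] (q : ℕ)
    {f : E → OGroup K p} (hf : ContDiff ℝ ∞ fun x => (f x : Matrix (Fin p) (Fin p) K)) :
    ContDiff ℝ ∞ fun x => ((involution q (f x)).1 : Matrix (Fin p) (Fin p) K) :=
  (hf.matrix_mul contDiff_const).matrix_mul (contDiff_conjTranspose.comp hf)

theorem dSmooth_grassmannianToInvolution :
    DSmooth (grassmannianToInvolution : GrassmannianUnion K p → HermitianUnitary K p) := by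
  intro N f hf
  change ContDiff ℝ ∞ fun x => ((grassmannianToInvolution (f x)).1 : Matrix (Fin p) (Fin p) K)
  refine contDiff_iff_contDiffAt.mpr fun x => ?_
  obtain ⟨q, r, hr, hfr⟩ := hf x
  obtain ⟨_, B, hB, hrB⟩ := hr x
  have hB' : ContDiff ℝ ∞ fun y => (B y : Matrix (Fin p) (Fin p) K) := hB
  refine (contDiff_involution (q : ℕ) hB').contDiffAt.congr_of_eventuallyEq ?_
  filter_upwards [hfr, hrB] with y h1 h2
  rw [h1, h2, grassmannianToInvolution_mk]

/-- A smooth family of Hermitian unitary matrices lifts locally to a smooth family in `O(p, K)`. -/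
theorem IsRealPart.exists_plot_involution_eq {re : K →ₗ[ℝ] ℝ} (hre : IsRealPart re) {N : ℕ}
    {f : EuclideanSpace ℝ (Fin N) → HermitianUnitary K p} (hf : IsPlot f)
    (x : EuclideanSpace ℝ (Fin N)) :
    ∃ (q : Fin (p + 1)) (B : EuclideanSpace ℝ (Fin N) → OGroup K p), IsPlot B ∧
      ∀ᶠ y in 𝓝 x, involution (q : ℕ) (B y) = f y := by
  have hf' : ContDiff ℝ ∞ fun y => ((f y).1 : Matrix (Fin p) (Fin p) K) := hf
  obtain ⟨q, B₀, hB₀⟩ := hre.exists_involution_eq (f x)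
  obtain ⟨g, hg⟩ := exists_local_conjugation (f x)
  have hg' := hf'.continuous.continuousAt.eventually hg
  obtain ⟨u, hu, huo, hxu⟩ := eventually_nhds_iff.mp hg'
  classical
  -- The lift makes sense only near `x`; away from it the value `1` is arbitrary, and the lift is
  -- replaced by a global plot with the same germ at `x`.
  let r : EuclideanSpace ℝ (Fin N) → OGroup K p := fun y =>
    if hy : y ∈ u then
      ⟨g (f y).1, ((hu y hy).2 (f y).2 (f y).1.2).1⟩ * B₀
    else 1
  have hr : ∀ y ∈ u, (r y : Matrix (Fin p) (Fin p) K) = g (f y).1 * B₀ := fun y hy => by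
    simp only [r, dif_pos hy]
    rfl
  obtain ⟨B, hB, hrB⟩ := DiffeologicalSpace.exists_plot_eventuallyEq
    (plot := fun d (p' : EuclideanSpace ℝ (Fin d) → OGroup K p) => IsPlot p') (p := r) (x := x)
    ⟨u, huo, hxu, fun {d h} hh hs => by
      have hlift : ContDiff ℝ ∞ fun y => g (f (h y)).1 * (B₀ : Matrix (Fin p) (Fin p) K) := by
        refine contDiff_iff_contDiffAt.mpr fun y => ContDiffAt.matrix_mul ?_ contDiffAt_const
        have h1 : ContDiff ℝ ∞ fun y => ((f (h y)).1 : Matrix (Fin p) (Fin p) K) := hf'.comp hs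
        exact ContDiffAt.comp (g := g) y (hu _ (hh y)).1 h1.contDiffAt
      have h2 : (fun y => (r (h y) : Matrix (Fin p) (Fin p) K)) =
          fun y => g (f (h y)).1 * (B₀ : Matrix (Fin p) (Fin p) K) :=
        funext fun y => hr _ (hh y)
      change ContDiff ℝ ∞ fun y => (r (h y) : Matrix (Fin p) (Fin p) K)
      rw [h2]
      exact hlift⟩
  refine ⟨q, B, hB, ?_⟩
  filter_upwards [hrB, huo.mem_nhds hxu] with y h1 h2
  rw [← h1]
  apply Subtype.ext
  apply Subtype.ext
  have h3 : ((f x).1 : Matrix (Fin p) (Fin p) K) =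
      (B₀ : Matrix (Fin p) (Fin p) K) * realDiagonal K (blockSign p q) *
        (B₀ : Matrix (Fin p) (Fin p) K)ᴴ := by
    rw [← hB₀]
    rfl
  change (r y : Matrix (Fin p) (Fin p) K) * realDiagonal K (blockSign p q) *
    (r y : Matrix (Fin p) (Fin p) K)ᴴ = (f y).1
  rw [((hu y h2).2 (f y).2 (f y).1.2).2, hr y h2, h3, Matrix.conjTranspose_mul]
  simp only [mul_assoc]

/-- `Σ(p)` is the space of Hermitian unitary matrices. -/
noncomputable def IsRealPart.grassmannianUnionEquiv {re : K →ₗ[ℝ] ℝ} (hre : IsRealPart re)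
    (p : ℕ) : SmoothEquiv (HermitianUnitary K p) (GrassmannianUnion K p) where
  toEquiv := (Equiv.ofBijective _ hre.grassmannianToInvolution_bijective).symm
  smooth_toFun N f hf x := by
    obtain ⟨q, B, hB, h⟩ := hre.exists_plot_involution_eq hf x
    refine ⟨q, fun y => QuotientGroup.mk (B y), fun y => ⟨(), B, hB, Filter.EventuallyEq.rfl⟩, ?_⟩
    filter_upwards [h] with y hy
    change (Equiv.ofBijective _ hre.grassmannianToInvolution_bijective).symm (f y) = _
    rw [Equiv.symm_apply_eq]
    exact hy.symm
  smooth_invFun := dSmooth_grassmannianToInvolution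

end

/-! ### The critical set as a submanifold and as a product -/

theorem theorem2p1 {K : Type} [NormedDivisionRing K] [NormedAlgebra ℝ K] [StarRing K]
    [FiniteDimensional ℝ K] (re : K → ℝ) (hK : IsRCH K re)
    (n : ℕ) (X : Matrix (Fin n) (Fin n) K)
    (k : ℕ) (t : Fin k → ℝ) (ht : StrictMono t)
    (ht_range : Set.range t = {s : ℝ | 0 < s ∧ IsSingularValue X s})
    (n₀ : ℕ) (hn₀ : n₀ = singularMultiplicity X 0)
    (m : Fin k → ℕ) (hm : ∀ q, m q = singularMultiplicity X (t q)) :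
    IsSmoothSubmanifold
        ((fun A : OGroup K n => (A : Matrix (Fin n) (Fin n) K)) ''
          criticalSet (heightFunction re X)) ∧
      Nonempty (SmoothEquiv (criticalSet (heightFunction re X))
        (OGroup K n₀ × (∀ q : Fin k, GrassmannianUnion K (m q)))) := by
  obtain ⟨_, re, rfl, hre⟩ := hK.exists_isRealPart
  constructor
  · have h : (fun A : OGroup K n => (A : Matrix (Fin n) (Fin n) K)) ''
        criticalSet (heightFunction re X) =
        {A | A ∈ unitary (Matrix (Fin n) (Fin n) K) ∧ (Xᴴ * A).IsHermitian} := by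
      ext A
      constructor
      · rintro ⟨A, hA, rfl⟩
        exact ⟨A.2, hre.isHermitian_of_mem_criticalSet hA⟩
      · rintro ⟨hA, hXA⟩
        exact ⟨⟨A, hA⟩, hre.mem_criticalSet_of_isHermitian hXA, rfl⟩
    rw [h]
    exact isSmoothSubmanifold_unitary_isHermitian X
  · obtain ⟨U, hU, V, hV, d, hd, hX⟩ := hre.exists_svd X
    obtain rfl : m = fun q => singularMultiplicity X (t q) := funext hm
    subst hn₀
    obtain ⟨e, he⟩ := exists_equiv_singular_values hU hV hd hX ht ht_range
    have htpos : ∀ q, 0 < t q := fun q => (ht_range ▸ Set.mem_range_self q : t q ∈ {s | _}).1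
    exact ⟨(hre.criticalSetEquiv hU hV hd hX htpos ht.injective he).trans
      ((SmoothEquiv.refl _).prodCongr
        (SmoothEquiv.piCongrRight fun q => hre.grassmannianUnionEquiv _))⟩
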